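/- Fix a positive integer $k$ of colors and order the colored nonnegative integers by $0_1\prec 0_2\prec\cdots\prec 0_k\prec 1_1\prec\cdots\prec 1_k\prec 2_1\prec\cdots$. A $k$-colored generalized Frobenius partition of $n$ is a two-row array $\begin{pmatrix} a_1,a_2,\dots,a_r\\ b_1,b_2,\dots,b_r\end{pmatrix}$ of colored nonnegative integers ($r\ge 0$) with $a_r\prec\cdots\prec a_1$, $b_r\prec\cdots\prec b_1$ and $n=r+\sum_{i=1}^r(a_i+b_i)$, where colors are ignored in the sum. Let $c\phi_3(n)$ denote the number of $3$-colored generalized Frobenius partitions of $n$. Theorem. For all integers $k\ge 3$ and $n\ge 0$, \begin{align*} c\phi_{3}\Big(3^{2k}n+\frac{7\cdot 3^{2k}+1}{8}\Big) &\equiv 0 \pmod{3^{4k+5}},\\ c\phi_{3}\Big(3^{2k+1}n+\frac{5\cdot 3^{2k+1}+1}{8}\Big) &\equiv 0 \pmod{3^{4k+6}},\\ c\phi_{3}\Big(3^{2k+1}n+\frac{23\cdot 3^{2k}+1}{8}\Big) &\equiv 0 \pmod{3^{4k+7}},\\ c\phi_{3}\Big(3^{2k+2}n+\frac{13\cdot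 3^{2k+1}+1}{8}\Big) &\equiv 0 \pmod{3^{4k+8}}. \end{align*} -/

import Mathlib

/-- Nonnegative integers `m_i` in `k` colors. The lexicographic order is
`0_1 < 0_2 < ⋯ < 0_k < 1_1 < ⋯ < 1_k < 2_1 < ⋯`. -/
abbrev ColoredNat (k : ℕ) : Type := ℕ ×ₗ Fin k

/-- The nonnegative integer underlying a colored integer. -/
def ColoredNat.val {k : ℕ} (c : ColoredNat k) : ℕ := (ofLex c).1

/-- The `k`-colored generalized Frobenius partitions of `n`: pairs of rows `a_1, …, a_r` and
`b_1, …, b_r` of colored integers, of the same length `r`, both strictly decreasing,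
with `n = r + ∑ (a_i + b_i)`. -/
def coloredFrobeniusPartitions (k n : ℕ) : Set (List (ColoredNat k) × List (ColoredNat k)) :=
  {p | p.1.length = p.2.length ∧
    p.1.Pairwise (fun x y => y < x) ∧ p.2.Pairwise (fun x y => y < x) ∧
    n = p.1.length + ((p.1.map ColoredNat.val).sum + (p.2.map ColoredNat.val).sum)}

/-- There are only finitely many of them, so that the count below is a genuine one. -/
theorem coloredFrobeniusPartitions_finite (k n : ℕ) :
    (coloredFrobeniusPartitions k n).Finite := by
  let f : Fin (n + 1) × Fin k → ColoredNat k := fun x => toLex (x.1.val, x.2)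
  have hf : {l : List (ColoredNat k) | l.length ≤ n ∧ (l.map ColoredNat.val).sum ≤ n}.Finite := by
    refine ((List.finite_length_le (Fin (n + 1) × Fin k) n).image (List.map f)).subset ?_
    rintro l ⟨hl, hs⟩
    have hr : l ∈ Set.range (List.map f) := by
      rw [Set.range_list_map]
      intro c hc
      have h1 : c.val ≤ n :=
        (List.single_le_sum (by simp) _ (List.mem_map_of_mem hc)).trans hs
      exact ⟨(⟨c.val, Nat.lt_succ_of_le h1⟩, (ofLex c).2), rfl⟩
    obtain ⟨l', rfl⟩ := hr
    exact ⟨l', by simpa using hl, rfl⟩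
  refine (hf.prod hf).subset ?_
  rintro ⟨a, b⟩ ⟨h1, -, -, h2⟩
  simp only at h1 h2
  refine ⟨⟨?_, ?_⟩, ⟨?_, ?_⟩⟩ <;> simp only <;> omega

/-- `cφ_k(n)`, the number of `k`-colored generalized Frobenius partitions of `n`. -/
noncomputable def cphi (k n : ℕ) : ℕ := (coloredFrobeniusPartitions k n).ncard

open Finset PowerSeries
open scoped PowerSeries

/-! Write `E` for `(q;q)_∞`, `U` for `extract`, and `f(q³)` for `dilate f`. Reading a partition as
two sets of colored integers makes `cφ₃` the constant term in `z` of the cube of `∏ (1 + z q^(i+1))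
(1 + z⁻¹ q^i)`. By the Jacobi triple product, `E³ ∑ cφ₃(n) qⁿ` is the theta series of the lattice
`m₁ + m₂ + m₃ = 0`. Twisting that series by a cube root of unity turns it into the product `E³ /
E(q³)`, and comparing the two residue class by residue class identifies it with the Borwein function
`a` (`cubicTheta`). So the generating function is `a / E³`.

Let `w = q E(q⁹)³ / E³` (`hauptNine`) and `t = q E(q³)¹² / E¹²` (`hauptThree`). Two relations drive
the proof: `t = w + 9w² + 27w³`, and the cubic equation `w³ = t(q³) (1 + 9w + 27w²)`. The cubic
gives `U(a wⁱ) = a Vᵢ(t)` with polynomials `Vᵢ` obeying a three-term recurrence. Hence `U`, preceded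
by multiplication by `q` at every other step, maps series `E⁻³ a p(t)` and `E(q³)⁻³ a p(t)` to one
another, with explicit maps on `p` (`extract_even`, `extract_odd`).

It remains to follow 3-adic valuations of the coefficients of `p`, bounded below by lines of slope
3/2 and 9/2 in the degree. Two consecutive extractions gain `3⁵` (`polyHalfDvd_step_odd`,
`polyHalfDvd_step_even`). In two of the four progressions a further `3²` comes from reducing the
linear term modulo 9. The exponents found grow like `5k`; they dominate those claimed, which grow
like `4k`, precisely from `k = 3` on. -/

/-! ### The Euler product and Gaussian binomials -/

/-- The finite product `(q; q)_n`. -/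
noncomputable def qPoch (n : ℕ) : ℤ⟦X⟧ := ∏ i ∈ range n, (1 - X ^ (i + 1))

theorem qPoch_succ (n : ℕ) : qPoch (n + 1) = qPoch n * (1 - X ^ (n + 1)) := prod_range_succ _ _

@[simp]
theorem qPoch_zero : qPoch 0 = 1 := rfl

theorem constantCoeff_qPoch (n : ℕ) : constantCoeff (qPoch n) = 1 := by
  simp [qPoch, map_prod]

/-- Euler's product `(q; q)_∞`. -/
noncomputable def eulerSeries : ℤ⟦X⟧ := mk fun n => coeff n (qPoch n)

theorem coeff_qPoch_of_le {n N : ℕ} (h : n ≤ N) : coeff n (qPoch N) = coeff n (qPoch n) := by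
  induction N, h using Nat.le_induction with
  | base => rfl
  | succ N hN ih =>
    rw [qPoch_succ, mul_sub, mul_one, map_sub, ih, coeff_mul_X_pow', if_neg (by lia), sub_zero]

theorem X_pow_dvd_eulerSeries_sub_qPoch (N : ℕ) :
    (X : ℤ⟦X⟧) ^ (N + 1) ∣ eulerSeries - qPoch N := by
  rw [X_pow_dvd_iff]
  intro m hm
  rw [map_sub, eulerSeries, coeff_mk, coeff_qPoch_of_le (by lia : m ≤ N), sub_self]

theorem constantCoeff_eulerSeries : constantCoeff eulerSeries = 1 := by
  rw [← coeff_zero_eq_constantCoeff_apply, eulerSeries, coeff_mk, qPoch_zero]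
  simp

/-- `1 / (q; q)_n`. -/
noncomputable def qPochInv (n : ℕ) : ℤ⟦X⟧ := invOfUnit (qPoch n) 1

theorem qPoch_mul_qPochInv (n : ℕ) : qPoch n * qPochInv n = 1 :=
  mul_invOfUnit _ _ (by simp [constantCoeff_qPoch])

@[simp]
theorem qPochInv_zero : qPochInv 0 = 1 := by
  simpa using qPoch_mul_qPochInv 0

theorem qPochInv_eq (n : ℕ) : qPochInv n = (1 - X ^ (n + 1)) * qPochInv (n + 1) := by
  have h1 := qPoch_mul_qPochInv n
  have h2 := qPoch_mul_qPochInv (n + 1)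
  rw [qPoch_succ] at h2
  linear_combination qPochInv n * (-h2) + (1 - X ^ (n + 1)) * qPochInv (n + 1) * h1

/-- The Gaussian binomial coefficient `[a + b choose a]_q`. -/
noncomputable def gaussBinom (a b : ℕ) : ℤ⟦X⟧ := qPoch (a + b) * qPochInv a * qPochInv b

theorem gaussBinom_comm (a b : ℕ) : gaussBinom a b = gaussBinom b a := by
  rw [gaussBinom, gaussBinom, add_comm]; ring

@[simp]
theorem gaussBinom_zero_left (b : ℕ) : gaussBinom 0 b = 1 := by
  simp [gaussBinom, qPoch_mul_qPochInv]

@[simp]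
theorem gaussBinom_zero_right (a : ℕ) : gaussBinom a 0 = 1 := by
  simp [gaussBinom, qPoch_mul_qPochInv]

theorem gaussBinom_succ_succ (a b : ℕ) :
    gaussBinom (a + 1) (b + 1) =
      gaussBinom (a + 1) b + X ^ (b + 1) * gaussBinom a (b + 1) := by
  simp only [gaussBinom]
  rw [show a + 1 + (b + 1) = a + b + 1 + 1 by ring, show a + 1 + b = a + b + 1 by ring,
    show a + (b + 1) = a + b + 1 by ring, qPoch_succ (a + b + 1), qPochInv_eq a, qPochInv_eq b]
  ring

theorem gaussBinom_succ_succ' (a b : ℕ) :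
    gaussBinom (a + 1) (b + 1) =
      gaussBinom a (b + 1) + X ^ (a + 1) * gaussBinom (a + 1) b := by
  rw [gaussBinom_comm, gaussBinom_succ_succ, gaussBinom_comm, gaussBinom_comm b]

/-- Modulo `X ^ (n + 1)` the products `qPoch a`, `qPoch b` and `qPoch (a + b)` all agree with
Euler's product, so the binomial is its inverse. -/
theorem X_pow_dvd_eulerSeries_mul_gaussBinom_sub_one {a b n : ℕ} (ha : n ≤ a) (hb : n ≤ b) :
    (X : ℤ⟦X⟧) ^ (n + 1) ∣ eulerSeries * gaussBinom a b - 1 := by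
  have key (c : ℕ) (hc : n ≤ c) : (X : ℤ⟦X⟧) ^ (n + 1) ∣ eulerSeries - qPoch c :=
    (pow_dvd_pow _ (by lia)).trans (X_pow_dvd_eulerSeries_sub_qPoch c)
  obtain ⟨u, hu⟩ := key a ha
  obtain ⟨v, hv⟩ := key b hb
  obtain ⟨x, hx⟩ := key (a + b) (by lia)
  have h1 := qPoch_mul_qPochInv a
  have h2 := qPoch_mul_qPochInv b
  have hE : eulerSeries * invOfUnit eulerSeries 1 = 1 :=
    mul_invOfUnit _ _ (by simp [constantCoeff_eulerSeries])
  set I := invOfUnit eulerSeries 1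
  set E := eulerSeries
  have h3 : E * gaussBinom a b - 1 = E * (E * qPochInv a * qPochInv b * (qPoch (a + b)) - 1) * I := by
    rw [gaussBinom]; linear_combination (1 - E * qPoch (a + b) * qPochInv a * qPochInv b) * hE
  have h4 : E * (qPochInv a * E) * (qPochInv b * qPoch (a + b)) - E =
      X ^ (n + 1) * (E * (qPochInv a * u) * (qPochInv b * qPoch (a + b))
        + E * (v - x) * qPochInv b) := by
    have ea : qPochInv a * E = 1 + X ^ (n + 1) * (qPochInv a * u) := by
      linear_combination qPochInv a * hu + h1
    have eb : qPochInv b * qPoch (a + b) = 1 + X ^ (n + 1) * ((v - x) * qPochInv b) := by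
      linear_combination qPochInv b * (hv - hx) + h2
    rw [ea]
    linear_combination E * eb
  refine ⟨(E * (qPochInv a * u) * (qPochInv b * qPoch (a + b)) + E * (v - x) * qPochInv b) * I, ?_⟩
  rw [h3]
  linear_combination I * h4

/-- Pascal's rule followed by an index shift. Since `g` is arbitrary, adjoining a factor to the
triple product becomes a termwise comparison; the two Pascal rules serve the two kinds of factor. -/
theorem sum_gaussBinom_succ {S : Type*} [CommRing S] (ι : ℤ⟦X⟧ →+* S) (g : ℕ → S) (n : ℕ) :
    ∑ a ∈ range (n + 2), ι (gaussBinom a (n + 1 - a)) * g a =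
      ∑ a ∈ range (n + 1), ι (gaussBinom a (n - a)) * (g a + ι X ^ (n - a) * g (a + 1)) := by
  have h : ∀ a ∈ range n, ι (gaussBinom (a + 1) (n + 1 - (a + 1))) * g (a + 1) =
      ι (gaussBinom (a + 1) (n - (a + 1))) * g (a + 1) +
        ι (gaussBinom a (n - a)) * (ι X ^ (n - a) * g (a + 1)) := by
    intro a ha
    obtain ⟨b, rfl⟩ := Nat.exists_eq_add_of_lt (mem_range.1 ha)
    rw [show a + b + 1 + 1 - (a + 1) = b + 1 by lia, show a + b + 1 - (a + 1) = b by lia,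
      show a + b + 1 - a = b + 1 by lia, gaussBinom_succ_succ]
    simp only [map_add, map_mul, map_pow]
    ring
  simp only [mul_add, sum_add_distrib]
  rw [sum_range_succ, sum_range_succ', sum_congr rfl h, sum_add_distrib,
    sum_range_succ' (fun a => ι (gaussBinom a (n - a)) * g a),
    sum_range_succ (fun a => ι (gaussBinom a (n - a)) * (ι X ^ (n - a) * g (a + 1)))]
  simp
  ring

theorem sum_gaussBinom_succ' {S : Type*} [CommRing S] (ι : ℤ⟦X⟧ →+* S) (g : ℕ → S) (n : ℕ) :
    ∑ a ∈ range (n + 2), ι (gaussBinom a (n + 1 - a)) * g a =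
      ∑ a ∈ range (n + 1), ι (gaussBinom a (n - a)) * (g (a + 1) + ι X ^ a * g a) := by
  have h : ∀ a ∈ range n, ι (gaussBinom (a + 1) (n + 1 - (a + 1))) * g (a + 1) =
      ι (gaussBinom a (n - a)) * g (a + 1) +
        ι (gaussBinom (a + 1) (n - (a + 1))) * (ι X ^ (a + 1) * g (a + 1)) := by
    intro a ha
    obtain ⟨b, rfl⟩ := Nat.exists_eq_add_of_lt (mem_range.1 ha)
    rw [show a + b + 1 + 1 - (a + 1) = b + 1 by lia, show a + b + 1 - (a + 1) = b by lia,
      show a + b + 1 - a = b + 1 by lia, gaussBinom_succ_succ']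
    simp only [map_add, map_mul, map_pow]
    ring
  simp only [mul_add, sum_add_distrib]
  rw [sum_range_succ, sum_range_succ', sum_congr rfl h, sum_add_distrib,
    sum_range_succ (fun a => ι (gaussBinom a (n - a)) * g (a + 1)),
    sum_range_succ' (fun a => ι (gaussBinom a (n - a)) * (ι X ^ a * g a))]
  simp
  ring

/-! ### The Jacobi triple product -/

/-- The triangular number `m (m + 1) / 2` of an integer. -/
def triangular (m : ℤ) : ℕ := (m * (m + 1) / 2).toNat

theorem two_mul_triangular (m : ℤ) : 2 * (triangular m : ℤ) = m * (m + 1) := by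
  have h0 : 0 ≤ m * (m + 1) := by
    rcases le_or_gt 0 m with h | h
    · positivity
    · nlinarith
  have h2 : 2 ∣ m * (m + 1) := (Int.even_mul_succ_self m).two_dvd
  rw [triangular, Int.toNat_of_nonneg (by positivity)]
  exact Int.mul_ediv_cancel' h2

theorem triangular_succ (m : ℤ) : (triangular (m + 1) : ℤ) = triangular m + m + 1 := by
  have h1 := two_mul_triangular m
  have h2 := two_mul_triangular (m + 1)
  linarith

theorem abs_le_triangular_add_one (m : ℤ) : |m| ≤ triangular m + 1 := by
  have h := two_mul_triangular m
  rcases abs_cases m with ⟨h1, h2⟩ | ⟨h1, h2⟩ <;> rw [h1] <;> nlinarith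

section JacobiTripleProduct

variable {S : Type*} [CommRing S]

/-- The partial product `∏_{i < M} (1 + u q^{i+1}) ∏_{i < N} (1 + u⁻¹ q^i)`. -/
def tripleProd (u : Sˣ) (q : S) (M N : ℕ) : S :=
  (∏ i ∈ range M, (1 + u * q ^ (i + 1))) * ∏ i ∈ range N, (1 + (u⁻¹ : Sˣ) * q ^ i)

/-- The partial theta sum `∑_{-N ≤ m ≤ N} u^m q^{m(m+1)/2}`. -/
noncomputable def thetaSum (u : Sˣ) (q : S) (N : ℕ) : S :=
  ∑ m ∈ Icc (-N : ℤ) N, ((u ^ m : Sˣ) : S) * q ^ triangular m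

/-- A finite triple product, equivalent to the q-binomial theorem, so that no convergence in `S` is
needed. -/
theorem tripleProd_eq_sum (ι : ℤ⟦X⟧ →+* S) (u : Sˣ) (M N : ℕ) :
    tripleProd u (ι X) M N = ∑ a ∈ range (M + N + 1), ι (gaussBinom a (M + N - a)) *
      (((u ^ (a - N : ℤ) : Sˣ) : S) * ι X ^ triangular (a - N)) := by
  induction M with
  | zero =>
    induction N with
    | zero => simp [tripleProd, triangular]
    | succ N ih =>
      have h1 : tripleProd u (ι X) 0 (N + 1) =
          tripleProd u (ι X) 0 N * (1 + (u⁻¹ : Sˣ) * ι X ^ N) := by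
        simp only [tripleProd, prod_range_succ]; ring
      rw [h1, ih]
      simp only [zero_add]
      rw [sum_gaussBinom_succ', sum_mul]
      refine sum_congr rfl fun a ha => ?_
      have e1 : ((a + 1 : ℕ) - (N + 1 : ℕ) : ℤ) = a - N := by push_cast; ring
      have e2 : u ^ (a - (N + 1 : ℕ) : ℤ) = u ^ (a - N : ℤ) * u⁻¹ := by
        rw [← zpow_sub_one]; congr 1; push_cast; ring
      have e3 : a + triangular (a - (N + 1 : ℕ)) = N + triangular (a - N) := by
        have := triangular_succ (a - (N + 1 : ℕ))
        rw [show ((a : ℤ) - (N + 1 : ℕ) + 1) = a - N by push_cast; ring] at this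
        push_cast at this ⊢
        lia
      have e4 (x : S) : ι X ^ a * (x * ι X ^ triangular (a - (N + 1 : ℕ))) =
          x * (ι X ^ (a + triangular (a - (N + 1 : ℕ)))) := by rw [pow_add]; ring
      rw [e1, e2, e4, e3, pow_add]
      push_cast
      ring
  | succ M ih =>
    have h1 : tripleProd u (ι X) (M + 1) N =
        tripleProd u (ι X) M N * (1 + u * ι X ^ (M + 1)) := by
      simp only [tripleProd, prod_range_succ]; ring
    rw [h1, ih, show M + 1 + N = M + N + 1 by ring, sum_gaussBinom_succ, sum_mul]
    refine sum_congr rfl fun a ha => ?_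
    have e1 : ((a + 1 : ℕ) - N : ℤ) = a - N + 1 := by push_cast; ring
    have e3 : M + N - a + triangular (a - N + 1) = M + 1 + triangular (a - N) := by
      have := triangular_succ (a - N)
      have := mem_range.1 ha
      lia
    have e4 (x : S) : ι X ^ (M + N - a) * (x * ι X ^ triangular (a - N + 1)) =
        x * (ι X ^ (M + N - a + triangular (a - N + 1))) := by rw [pow_add]; ring
    rw [e1, e4, e3, zpow_add_one, pow_add]
    push_cast
    ring

theorem thetaSum_eq_sum_range (u : Sˣ) (q : S) (N : ℕ) :
    thetaSum u q N = ∑ a ∈ range (N + N + 1),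
      ((u ^ (a - N : ℤ) : Sˣ) : S) * q ^ triangular (a - N) := by
  symm
  refine sum_bij' (fun a _ => (a - N : ℤ)) (fun m _ => (m + N).toNat) ?_ ?_ ?_ ?_ ?_
  all_goals simp only [mem_range, mem_Icc]
  all_goals intros
  all_goals lia

/-- **Jacobi triple product**, modulo `q ^ N`. -/
theorem pow_dvd_euler_mul_tripleProd_sub_thetaSum (ι : ℤ⟦X⟧ →+* S) (u : Sˣ) (N : ℕ) :
    ι X ^ N ∣ ι eulerSeries * tripleProd u (ι X) N N - thetaSum u (ι X) N := by
  rw [tripleProd_eq_sum, thetaSum_eq_sum_range, mul_sum, ← sum_sub_distrib]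
  refine dvd_sum fun a ha => ?_
  have ha := mem_range.1 ha
  have h1 := map_dvd ι (X_pow_dvd_eulerSeries_mul_gaussBinom_sub_one
    (min_le_left a (N + N - a)) (min_le_right a (N + N - a)))
  have h2 := abs_le_triangular_add_one (a - N)
  -- Near the ends of the range the binomial approximates `1 / (q;q)_∞` badly, but there the theta
  -- exponent is large enough to compensate.
  have h3 : N ≤ min a (N + N - a) + 1 + triangular (a - N) := by
    rcases abs_cases (a - N : ℤ) with ⟨h, _⟩ | ⟨h, _⟩ <;> rw [h] at h2 <;> lia
  have e : ι eulerSeries * (ι (gaussBinom a (N + N - a)) *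
      (((u ^ (a - N : ℤ) : Sˣ) : S) * ι X ^ triangular (a - N))) -
      ((u ^ (a - N : ℤ) : Sˣ) : S) * ι X ^ triangular (a - N) =
      ι (eulerSeries * gaussBinom a (N + N - a) - 1) * ι X ^ triangular (a - N) *
        ((u ^ (a - N : ℤ) : Sˣ) : S) := by
    simp only [map_sub, map_mul, map_one]; ring
  rw [e]
  refine Dvd.dvd.mul_right ((pow_dvd_pow _ h3).trans ?_) _
  rw [pow_add]
  exact mul_dvd_mul (by simpa using h1) dvd_rfl

end JacobiTripleProduct

/-! ### Dilation and extraction -/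

section Dilation

variable {R : Type*} [CommRing R]

/-- The substitution `q ↦ q³`. -/
noncomputable abbrev dilate : R⟦X⟧ →ₐ[R] R⟦X⟧ := expand 3 three_ne_zero

/-- The operator `∑ aₙ qⁿ ↦ ∑ a₃ₙ qⁿ`. -/
noncomputable def extract : R⟦X⟧ →ₗ[R] R⟦X⟧ where
  toFun f := mk fun n => coeff (3 * n) f
  map_add' f g := by ext; simp
  map_smul' c f := by ext; simp

@[simp]
theorem coeff_extract (f : R⟦X⟧) (n : ℕ) : coeff n (extract f) = coeff (3 * n) f := by
  simp [extract]

theorem coeff_dilate_mul (f : R⟦X⟧) (n : ℕ) : coeff (3 * n) (dilate f) = coeff n f :=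
  coeff_expand_mul _ _ _ _

theorem extract_dilate_mul (g f : R⟦X⟧) : extract (dilate g * f) = g * extract f := by
  ext n
  rw [coeff_extract, coeff_mul, coeff_mul]
  symm
  refine sum_of_injOn (fun p => (3 * p.1, 3 * p.2)) ?_ ?_ ?_ ?_
  · intro p _ p' _ h
    simp only [Prod.mk.injEq] at h
    ext <;> lia
  · intro p hp
    simp only [mem_coe, HasAntidiagonal.mem_antidiagonal] at hp ⊢
    lia
  · intro p hp hp'
    rw [coeff_expand_of_not_dvd, zero_mul]
    rintro ⟨k, hk⟩
    refine hp' ⟨(k, n - k), ?_, ?_⟩ <;> simp only [mem_coe, HasAntidiagonal.mem_antidiagonal] at hp ⊢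
    all_goals first | lia | (ext <;> simp only <;> lia)
  · intro p _
    rw [coeff_dilate_mul, coeff_extract]

theorem extract_one : extract (1 : R⟦X⟧) = 1 := by
  ext n
  simp [coeff_one]

theorem extract_dilate (g : R⟦X⟧) : extract (dilate g) = g := by
  simpa [extract_one] using extract_dilate_mul g 1

theorem extract_X_mul_dilate (g : R⟦X⟧) : extract (X * dilate g) = 0 := by
  have h : extract (X : R⟦X⟧) = 0 := by
    ext n
    rw [coeff_extract, coeff_X, if_neg (by lia), map_zero]
  rw [mul_comm, extract_dilate_mul, h, mul_zero]

theorem extract_X_sq_mul_dilate (g : R⟦X⟧) : extract (X ^ 2 * dilate g) = 0 := by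
  have h : extract (X ^ 2 : R⟦X⟧) = 0 := by
    ext n
    rw [coeff_extract, coeff_X_pow, if_neg (by lia), map_zero]
  rw [mul_comm, extract_dilate_mul, h, mul_zero]

theorem dilate_X : dilate (X : R⟦X⟧) = X ^ 3 := expand_X _ _

theorem X_pow_dvd_dilate_sub {f g : R⟦X⟧} {N : ℕ} (h : X ^ N ∣ f - g) :
    X ^ (3 * N) ∣ dilate f - dilate g := by
  have := map_dvd dilate h
  rwa [map_pow, dilate_X, ← pow_mul, map_sub] at this

theorem eq_of_forall_X_pow_dvd_sub {f g : R⟦X⟧} (h : ∀ N, X ^ N ∣ f - g) : f = g := by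
  ext n
  have := X_pow_dvd_iff.1 (h (n + 1)) n (by lia)
  rwa [map_sub, sub_eq_zero] at this

theorem coeff_eq_of_X_pow_dvd_sub {f g : R⟦X⟧} {N n : ℕ} (h : X ^ N ∣ f - g) (hn : n < N) :
    coeff n f = coeff n g := by
  have := X_pow_dvd_iff.1 h n hn
  rwa [map_sub, sub_eq_zero] at this

theorem eq_dilate_extract {f : R⟦X⟧} (h : ∀ N, ∃ g, X ^ N ∣ f - dilate g) :
    f = dilate (extract f) := by
  ext n
  obtain ⟨g, hg⟩ := h (n + 1)
  by_cases hn : 3 ∣ n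
  · obtain ⟨k, rfl⟩ := hn
    rw [coeff_dilate_mul, coeff_extract]
  · rw [coeff_eq_of_X_pow_dvd_sub hg (by lia), coeff_expand_of_not_dvd _ _ _ hn,
      coeff_expand_of_not_dvd _ _ _ hn]

end Dilation

/-! ### Jacobi's identity for the cube of Euler's product -/

/-- The coefficient `(-1)^m (2m+1)`. -/
def jacobiCubeCoeff (m : ℕ) : ℤ := (-1) ^ m * (2 * m + 1)

/-- The partial sum `∑_{m < N} (-1)^m (2m+1) q^{m(m+1)/2}`. -/
noncomputable def jacobiCubeSum (N : ℕ) : ℤ⟦X⟧ :=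
  ∑ m ∈ range N, C (jacobiCubeCoeff m) * X ^ triangular m

theorem sum_Icc_neg_self {M : Type*} [AddCommMonoid M] (f : ℤ → M) (N : ℕ) :
    ∑ m ∈ Icc (-N : ℤ) N, f m = ∑ m ∈ range N, (f m + f (-m - 1)) + f N := by
  induction N with
  | zero => simp
  | succ N ih =>
    have h : Icc (-(N + 1 : ℕ) : ℤ) (N + 1 : ℕ) =
        insert (-N - 1 : ℤ) (insert (N + 1 : ℤ) (Icc (-N : ℤ) N)) := by
      ext; simp only [mem_Icc, mem_insert]; lia
    rw [h, sum_insert (by simp only [mem_Icc, mem_insert]; lia), sum_insert (by simp), ih,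
      sum_range_succ]
    push_cast
    abel

-- The triple product at `u = -(1 + ε)`: its `ε`-part is the derivative at the zero `u = -1`.
-- Pairing `m` with `-m - 1` on the theta side produces the coefficients `(-1)^m (2m+1)`.
open DualNumber TrivSqZeroExt in
theorem X_pow_dvd_eulerSeries_cube_sub (N : ℕ) :
    (X : ℤ⟦X⟧) ^ N ∣ eulerSeries ^ 3 - jacobiCubeSum N := by
  rcases N with _ | N
  · simp
  let u : (ℤ⟦X⟧[ε])ˣ := ⟨-(1 + ε), -(1 - ε),
    by linear_combination (-1 : ℤ⟦X⟧[ε]) * DualNumber.eps_mul_eps (R := ℤ⟦X⟧),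
    by linear_combination (-1 : ℤ⟦X⟧[ε]) * DualNumber.eps_mul_eps (R := ℤ⟦X⟧)⟩
  have hu : (u : ℤ⟦X⟧[ε]) = -(1 + ε) := rfl
  have hu' : ((u⁻¹ : (ℤ⟦X⟧[ε])ˣ) : ℤ⟦X⟧[ε]) = -(1 - ε) := rfl
  have hpow (n : ℕ) : (-(1 + ε) : ℤ⟦X⟧[ε]) ^ n = (-1) ^ n * (1 + (n : ℤ⟦X⟧[ε]) * ε) := by
    induction n with
    | zero => simp
    | succ n ih =>
      rw [pow_succ, ih]; push_cast
      linear_combination (-1 : ℤ⟦X⟧[ε]) ^ n * (-n) * DualNumber.eps_mul_eps (R := ℤ⟦X⟧)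
  have hpow' (n : ℕ) : (-(1 - ε) : ℤ⟦X⟧[ε]) ^ n = (-1) ^ n * (1 - (n : ℤ⟦X⟧[ε]) * ε) := by
    induction n with
    | zero => simp
    | succ n ih =>
      rw [pow_succ, ih]; push_cast
      linear_combination (-1 : ℤ⟦X⟧[ε]) ^ n * (-n) * DualNumber.eps_mul_eps (R := ℤ⟦X⟧)
  have hsnd (n : ℕ) (x : ℤ⟦X⟧[ε]) : snd ((-1) ^ n * x) = (-1) ^ n * snd x := by
    rcases neg_one_pow_eq_or ℤ⟦X⟧[ε] n with h | h <;>
    rcases Nat.even_or_odd n with h' | h' <;> simp [h'.neg_one_pow]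
  let ι : ℤ⟦X⟧ →+* ℤ⟦X⟧[ε] := inlHom ℤ⟦X⟧ ℤ⟦X⟧
  have hι (x : ℤ⟦X⟧) : ι x = inl x := rfl
  have hsndι (x : ℤ⟦X⟧) (y : ℤ⟦X⟧[ε]) : snd (y * ι x) = snd y * x := by
    rw [hι]; simp [mul_comm]
  have h1 := pow_dvd_euler_mul_tripleProd_sub_thetaSum ι u (N + 1)
  have h2 : X ^ (N + 1) ∣ snd (ι eulerSeries * tripleProd u (ι X) (N + 1) (N + 1)) -
      snd (thetaSum u (ι X) (N + 1)) := by
    obtain ⟨z, hz⟩ := h1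
    rw [← snd_sub, hz, ← map_pow, mul_comm, hsndι]
    exact dvd_mul_left _ _
  have h3 : snd (ι eulerSeries * tripleProd u (ι X) (N + 1) (N + 1)) =
      eulerSeries * (qPoch (N + 1) * qPoch N) := by
    -- The factor `i = 0` of the second product is `1 + u⁻¹ = ε`, so in all other factors only the
    -- value at `u = -1` matters.
    have e : tripleProd u (ι X) (N + 1) (N + 1) =
        (∏ i ∈ range (N + 1), (1 + u * ι X ^ (i + 1))) *
        (∏ i ∈ range N, (1 + (u⁻¹ : (ℤ⟦X⟧[ε])ˣ) * ι X ^ (i + 1))) * ε := by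
      rw [tripleProd, prod_range_succ' (fun i => 1 + (u⁻¹ : (ℤ⟦X⟧[ε])ˣ) * ι X ^ i), hu']
      ring
    have hfst (x : ℤ⟦X⟧[ε]) : snd (x * ε) = fst x := by simp
    rw [mul_comm, hsndι, e, hfst, mul_comm]
    congr 1
    have hf : ∀ x : ℤ⟦X⟧[ε], fst x = fstHom ℤ⟦X⟧ ℤ⟦X⟧ ℤ⟦X⟧ x := fun _ => rfl
    rw [hf, map_mul, map_prod, map_prod, qPoch, qPoch]
    congr 1 <;> refine prod_congr rfl fun i _ => ?_
    · rw [← hf, hu, ← map_pow, hι]; simp; ring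
    · rw [← hf, hu', ← map_pow, hι]; simp; ring
  have h4 : X ^ (N + 1) ∣ snd (thetaSum u (ι X) (N + 1)) - jacobiCubeSum (N + 1) := by
    have e (n : ℕ) : triangular (-n - 1) = triangular n := by
      have h1 := two_mul_triangular (-n - 1)
      have h2 := two_mul_triangular n
      have : (2 * triangular (-n - 1) : ℤ) = 2 * triangular n := by rw [h1, h2]; ring
      lia
    rw [thetaSum, sum_Icc_neg_self]
    have hs : snd (∑ m ∈ range (N + 1), (((u ^ (m : ℤ) : (ℤ⟦X⟧[ε])ˣ) : ℤ⟦X⟧[ε]) * ι X ^ triangular m +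
        ((u ^ (-m - 1 : ℤ) : (ℤ⟦X⟧[ε])ˣ) : ℤ⟦X⟧[ε]) * ι X ^ triangular (-m - 1))) =
        jacobiCubeSum (N + 1) := by
      have hs : ∀ x : ℤ⟦X⟧[ε], snd x = sndHom ℤ⟦X⟧ ℤ⟦X⟧ x := fun _ => rfl
      rw [hs, map_sum, jacobiCubeSum]
      refine sum_congr rfl fun m _ => ?_
      rw [e, show (-m - 1 : ℤ) = -((m + 1 : ℕ) : ℤ) by push_cast; ring, zpow_neg, zpow_natCast,
        zpow_natCast, ← inv_pow, Units.val_pow_eq_pow_val, Units.val_pow_eq_pow_val, hu, hu',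
        hpow, hpow', ← hs, snd_add, ← map_pow, hsndι, hsndι, hsnd, hsnd]
      simp [pow_succ, jacobiCubeCoeff]
      ring
    rw [snd_add, hs, add_sub_cancel_left, ← map_pow, hsndι]
    refine Dvd.dvd.mul_left (pow_dvd_pow _ ?_) _
    have h1 := two_mul_triangular (N + 1 : ℕ)
    push_cast at h1
    have : (N + 1 : ℤ) ≤ triangular (N + 1 : ℕ) := by push_cast; nlinarith
    lia
  have h5 : X ^ (N + 1) ∣ eulerSeries ^ 3 - eulerSeries * (qPoch (N + 1) * qPoch N) := by
    have e1 := X_pow_dvd_eulerSeries_sub_qPoch N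
    have e2 := X_pow_dvd_eulerSeries_sub_qPoch (N + 1)
    have := dvd_mul_sub_mul (sub_self eulerSeries ▸ dvd_zero (X ^ (N + 1)))
      (dvd_mul_sub_mul ((pow_dvd_pow _ (by lia)).trans e2) e1)
    convert! this using 2
    ring
  rw [h3] at h2
  convert! dvd_add (dvd_add h5 h2) h4 using 1
  ring

/-- Triangular numbers with index `0` or `2` mod 3 are multiples of 3, while index `3m + 1` gives `9
T(m) + 1` with coefficient `-3` times the `m`-th one. -/
theorem jacobiCubeSum_three_mul (N : ℕ) : ∃ g, jacobiCubeSum (3 * N) =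
    dilate g - 3 * X * dilate (dilate (jacobiCubeSum N)) := by
  induction N with
  | zero => exact ⟨0, by simp [jacobiCubeSum]⟩
  | succ N ih =>
    obtain ⟨g, hg⟩ := ih
    have e0 : ∃ k, triangular (3 * N : ℕ) = 3 * k := by
      have h1 := two_mul_triangular (3 * N : ℕ)
      have : (3 : ℤ) ∣ 2 * triangular (3 * N : ℕ) := ⟨N * (3 * N + 1), by rw [h1]; push_cast; ring⟩
      exact (by lia : 3 ∣ triangular (3 * N : ℕ))
    have e2 : ∃ k, triangular (3 * N + 2 : ℕ) = 3 * k := by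
      have h1 := two_mul_triangular (3 * N + 2 : ℕ)
      have : (3 : ℤ) ∣ 2 * triangular (3 * N + 2 : ℕ) :=
        ⟨(3 * N + 2) * (N + 1), by rw [h1]; push_cast; ring⟩
      exact (by lia : 3 ∣ triangular (3 * N + 2 : ℕ))
    have e1 : triangular (3 * N + 1 : ℕ) = 9 * triangular N + 1 := by
      have h1 := two_mul_triangular (3 * N + 1 : ℕ)
      have h2 := two_mul_triangular N
      have : (2 * triangular (3 * N + 1 : ℕ) : ℤ) = 9 * (2 * triangular N) + 2 := by
        rw [h1, h2]; push_cast; ring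
      lia
    obtain ⟨k, hk⟩ := e0
    obtain ⟨l, hl⟩ := e2
    refine ⟨g + C (jacobiCubeCoeff (3 * N)) * X ^ k +
      C (jacobiCubeCoeff (3 * N + 2)) * X ^ l, ?_⟩
    have h : jacobiCubeSum (3 * (N + 1)) = jacobiCubeSum (3 * N) +
        C (jacobiCubeCoeff (3 * N)) * X ^ (3 * k) +
        C (jacobiCubeCoeff (3 * N + 1)) * X ^ (9 * triangular N + 1) +
        C (jacobiCubeCoeff (3 * N + 2)) * X ^ (3 * l) := by
      rw [jacobiCubeSum, show 3 * (N + 1) = 3 * N + 1 + 1 + 1 by ring, sum_range_succ,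
        sum_range_succ, sum_range_succ, ← jacobiCubeSum, hk, e1,
        show 3 * N + 1 + 1 = 3 * N + 2 by ring, hl]
    have h' : jacobiCubeSum (N + 1) =
        jacobiCubeSum N + C (jacobiCubeCoeff N) * X ^ triangular N := sum_range_succ _ _
    have hC : (C (jacobiCubeCoeff (3 * N + 1)) : ℤ⟦X⟧) =
        -3 * C (jacobiCubeCoeff N) := by
      have : jacobiCubeCoeff (3 * N + 1) = -3 * jacobiCubeCoeff N := by
        rw [jacobiCubeCoeff, jacobiCubeCoeff, pow_succ, pow_mul]; push_cast; ring
      rw [this, map_mul]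
      simp
    rw [h, hg, h', hC]
    simp only [map_add, map_mul, map_pow, dilate_X, expand_C, ← pow_mul]
    rw [show 3 * 3 * triangular N = 9 * triangular N by ring]
    ring

theorem exists_eulerSeries_cube_eq : ∃ A, eulerSeries ^ 3 =
    dilate A - 3 * X * dilate (dilate eulerSeries) ^ 3 := by
  have h := eq_dilate_extract (f := eulerSeries ^ 3 + 3 * X * dilate (dilate eulerSeries) ^ 3) ?_
  · exact ⟨_, by rw [← h]; ring⟩
  intro N
  obtain ⟨g, hg⟩ := jacobiCubeSum_three_mul N
  refine ⟨g, ?_⟩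
  have h1 := (pow_dvd_pow X (by lia : N ≤ 3 * N)).trans (X_pow_dvd_eulerSeries_cube_sub (3 * N))
  have h2 := (pow_dvd_pow X (by lia : N ≤ 3 * (3 * N))).trans
    (X_pow_dvd_dilate_sub (X_pow_dvd_dilate_sub (X_pow_dvd_eulerSeries_cube_sub N)))
  convert! dvd_add h1 (Dvd.dvd.mul_left h2 (3 * X)) using 1
  rw [hg]
  simp only [map_pow]
  ring

/-! ### The norm of Euler's product -/

/-- The inclusion of integral power series in complex ones. -/
noncomputable abbrev toComplexSeries : ℤ⟦X⟧ →+* ℂ⟦X⟧ := map (Int.castRingHom ℂ)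

theorem toComplexSeries_injective : Function.Injective toComplexSeries := by
  intro f g h
  ext n
  have := congrArg (coeff n) h
  simpa using this

theorem toComplexSeries_dilate (f : ℤ⟦X⟧) :
    toComplexSeries (dilate f) = dilate (toComplexSeries f) := map_expand _ _ _ _

theorem cube_root_pow_three {ω : ℂ} (hω : ω ^ 2 + ω + 1 = 0) : ω ^ 3 = 1 := by linear_combination (ω - 1) * hω

theorem rescale_dilate {ω : ℂ} (h3 : ω ^ 3 = 1) (f : ℂ⟦X⟧) :
    rescale ω (dilate f) = dilate f := by
  ext n
  rw [coeff_rescale]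
  by_cases hn : 3 ∣ n
  · obtain ⟨k, rfl⟩ := hn
    rw [pow_mul, h3, one_pow, one_mul]
  · rw [coeff_expand_of_not_dvd _ _ _ hn, mul_zero]

theorem one_sub_mul_three (W : ℂ⟦X⟧) (hW : W ^ 2 + W + 1 = 0) (Y : ℂ⟦X⟧) :
    (1 - Y) * (1 - W * Y) * (1 - W ^ 2 * Y) = 1 - Y ^ 3 := by
  linear_combination (-Y + W * Y ^ 2 - (W - 1) * Y ^ 3) * hW

/-- Over the three twists `q ↦ ωʲ q`, a factor `1 - qⁱ` with `3 ∤ i` multiplies up to `1 - q^(3i)`,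
and one with `3 ∣ i` is cubed. The factor `E(q⁹)` of the limit clears the denominator left by
omitting multiples of 3. -/
theorem qPoch_norm {ω : ℂ} (hω : ω ^ 2 + ω + 1 = 0) (N : ℕ) :
    toComplexSeries (qPoch (3 * N)) * rescale ω (toComplexSeries (qPoch (3 * N))) *
      rescale (ω ^ 2) (toComplexSeries (qPoch (3 * N))) *
      toComplexSeries (dilate (dilate (qPoch N))) =
    toComplexSeries (dilate (qPoch (3 * N))) * toComplexSeries (dilate (qPoch N)) ^ 3 := by
  have hW : (C ω : ℂ⟦X⟧) ^ 2 + C ω + 1 = 0 := by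
    rw [← map_pow, ← map_add, ← map_one C, ← map_add, hω, map_zero]
  have h3 : (C ω : ℂ⟦X⟧) ^ 3 = 1 := by linear_combination (C ω - 1) * hW
  have h4 : ((C ω : ℂ⟦X⟧) ^ 2) ^ 3 = 1 := by rw [← pow_mul, mul_comm, pow_mul, h3, one_pow]
  induction N with
  | zero => simp
  | succ N ih =>
    have k1 := one_sub_mul_three (C ω) hW (X ^ (3 * N + 1))
    have k2 := one_sub_mul_three (C ω) hW (X ^ (3 * N + 2))
    rw [show 3 * (N + 1) = 3 * N + 1 + 1 + 1 by ring]
    simp only [qPoch_succ, map_mul, map_sub, map_one, map_pow, map_X, rescale_X, dilate_X, mul_pow]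
      at ih ⊢
    generalize toComplexSeries (qPoch (3 * N)) = a at *
    generalize toComplexSeries (dilate (qPoch (3 * N))) = b at *
    generalize toComplexSeries (dilate (qPoch N)) = c at *
    generalize toComplexSeries (dilate (dilate (qPoch N))) = d at *
    have p1 : (C ω : ℂ⟦X⟧) ^ (3 * N + 1) = C ω := by rw [pow_succ, pow_mul, h3]; simp
    have p2 : (C ω : ℂ⟦X⟧) ^ (3 * N + 1 + 1) = C ω ^ 2 := by rw [pow_succ, p1, sq]
    have p3 : (C ω : ℂ⟦X⟧) ^ (3 * N + 1 + 1 + 1) = 1 := by rw [pow_succ, p2, ← pow_succ, h3]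
    have q1 : ((C ω : ℂ⟦X⟧) ^ 2) ^ (3 * N + 1) = C ω ^ 2 := by rw [← pow_mul', pow_mul, p1]
    have q2 : ((C ω : ℂ⟦X⟧) ^ 2) ^ (3 * N + 1 + 1) = C ω := by
      rw [← pow_mul', pow_mul, p2, ← pow_mul]
      linear_combination C ω * h3
    have q3 : ((C ω : ℂ⟦X⟧) ^ 2) ^ (3 * N + 1 + 1 + 1) = 1 := by
      rw [← pow_mul', pow_mul, p3, one_pow]
    rw [p1, p2, p3, q1, q2, q3]
    have e1 : ((X : ℂ⟦X⟧) ^ 3) ^ (3 * N + 1) = (X ^ (3 * N + 1)) ^ 3 := by ring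
    have e2 : ((X : ℂ⟦X⟧) ^ 3) ^ (3 * N + 1 + 1) = (X ^ (3 * N + 2)) ^ 3 := by ring
    have e3 : ((X : ℂ⟦X⟧) ^ 3) ^ (3 * N + 1 + 1 + 1) = ((X ^ 3) ^ 3) ^ (N + 1) := by ring
    have e4 : ((X : ℂ⟦X⟧) ^ 3) ^ (N + 1) = X ^ (3 * N + 1 + 1 + 1) := by ring
    rw [e1, e2, e3, e4, ← k1, ← k2, show 3 * N + 2 = 3 * N + 1 + 1 by ring]
    generalize (X : ℂ⟦X⟧) ^ (3 * N + 1) = x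
    generalize (X : ℂ⟦X⟧) ^ (3 * N + 1 + 1) = y
    generalize (X : ℂ⟦X⟧) ^ (3 * N + 1 + 1 + 1) = z
    generalize ((X ^ 3) ^ 3 : ℂ⟦X⟧) ^ (N + 1) = v
    linear_combination ((1 - x) * (1 - C ω * x) * (1 - C ω ^ 2 * x)) *
      ((1 - y) * (1 - C ω * y) * (1 - C ω ^ 2 * y)) * (1 - z) ^ 3 * (1 - v) * ih

theorem eulerSeries_norm {ω : ℂ} (hω : ω ^ 2 + ω + 1 = 0) :
    toComplexSeries eulerSeries * rescale ω (toComplexSeries eulerSeries) *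
      rescale (ω ^ 2) (toComplexSeries eulerSeries) *
      toComplexSeries (dilate (dilate eulerSeries)) =
    toComplexSeries (dilate eulerSeries) * toComplexSeries (dilate eulerSeries) ^ 3 := by
  refine eq_of_forall_X_pow_dvd_sub fun N => ?_
  have h1 : (X : ℤ⟦X⟧) ^ N ∣ eulerSeries - qPoch (3 * N) :=
    (pow_dvd_pow _ (by lia)).trans (X_pow_dvd_eulerSeries_sub_qPoch (3 * N))
  have h2 : (X : ℤ⟦X⟧) ^ N ∣ eulerSeries - qPoch N :=
    (pow_dvd_pow _ (by lia)).trans (X_pow_dvd_eulerSeries_sub_qPoch N)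
  have hd {f g : ℤ⟦X⟧} (h : X ^ N ∣ f - g) : X ^ N ∣ dilate f - dilate g :=
    (pow_dvd_pow _ (by lia)).trans (X_pow_dvd_dilate_sub h)
  have hc {f g : ℤ⟦X⟧} (h : X ^ N ∣ f - g) : X ^ N ∣ toComplexSeries f - toComplexSeries g := by
    simpa using map_dvd toComplexSeries h
  have hr {f g : ℂ⟦X⟧} (c : ℂ) (h : X ^ N ∣ f - g) : X ^ N ∣ rescale c f - rescale c g := by
    have := map_dvd (rescale c) h
    rw [map_pow, rescale_X, map_sub, mul_pow] at this
    exact (dvd_mul_left _ _).trans this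
  have l := dvd_mul_sub_mul (dvd_mul_sub_mul (dvd_mul_sub_mul (hc h1) (hr ω (hc h1)))
    (hr (ω ^ 2) (hc h1))) (hc (hd (hd h2)))
  have r := dvd_mul_sub_mul (hc (hd h1)) ((hc (hd h2)).trans (sub_dvd_pow_sub_pow _ _ 3))
  rw [qPoch_norm hω] at l
  simpa using dvd_sub l r

theorem exists_cube_root : ∃ ω : ℂ, ω ^ 2 + ω + 1 = 0 := by
  have h := Complex.isPrimitiveRoot_exp 3 (by norm_num)
  have h' := h.geom_sum_eq_zero (by norm_num)
  simp only [sum_range_succ, sum_range_zero] at h'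
  exact ⟨_, by linear_combination h'⟩

/-- Two evaluations of the norm of `E³`: the product formula gives `E(q³)¹² / E(q⁹)³`, and the
trisection `E³ = B - 3θ`, with `B` a series in `q³` and `θ = q E(q⁹)³`, gives `B³ - 27θ³`.
Substituting `B = E³ + 3θ` gives the right side. -/
theorem dilate_eulerSeries_pow_twelve :
    dilate eulerSeries ^ 12 = dilate (dilate eulerSeries) ^ 3 *
      (eulerSeries ^ 9 + 9 * (X * dilate (dilate eulerSeries) ^ 3) * eulerSeries ^ 6 +
        27 * (X * dilate (dilate eulerSeries) ^ 3) ^ 2 * eulerSeries ^ 3) := by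
  obtain ⟨ω, hω⟩ := exists_cube_root
  obtain ⟨A, hA⟩ := exists_eulerSeries_cube_eq
  have h3 := cube_root_pow_three hω
  have hn := eulerSeries_norm hω
  have h1 := congrArg toComplexSeries hA
  have h2 := congrArg (rescale ω) h1
  have h4 := congrArg (rescale (ω ^ 2)) h1
  have h6 : (ω ^ 2) ^ 3 = 1 := by rw [← pow_mul, mul_comm, pow_mul, h3, one_pow]
  apply toComplexSeries_injective
  have hW : (C ω : ℂ⟦X⟧) ^ 2 + C ω + 1 = 0 := by
    rw [← map_pow, ← map_add, ← map_one C, ← map_add, hω, map_zero]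
  simp only [map_mul, map_add, map_sub, map_pow, map_ofNat, map_X, toComplexSeries_dilate,
    rescale_dilate h3, rescale_dilate h6, rescale_X] at h1 h2 h4 hn ⊢
  generalize toComplexSeries eulerSeries = E at *
  generalize rescale ω E = E' at *
  generalize rescale (ω ^ 2) E = E'' at *
  generalize dilate (toComplexSeries A) = B at *
  generalize dilate (dilate E) = F at *
  generalize dilate E = G at *
  generalize (X : ℂ⟦X⟧) = x at *
  generalize (C ω : ℂ⟦X⟧) = W at *
  have hn3 : (E * E' * E'' * F) ^ 3 = G ^ 12 := by rw [hn]; ring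
  have hF : E ^ 3 * E' ^ 3 * E'' ^ 3 = B ^ 3 - 27 * (x * F ^ 3) ^ 3 := by
    rw [h1, h2, h4]
    linear_combination (-3 * (x * F ^ 3) * B ^ 2 + 9 * (x * F ^ 3) ^ 2 * B * W -
      27 * (x * F ^ 3) ^ 3 * (W - 1)) * hW
  have hB : B = E ^ 3 + 3 * x * F ^ 3 := by rw [h1]; ring
  rw [← hn3]
  rw [hB] at hF
  linear_combination F ^ 3 * hF

/-! ### Colored Frobenius partitions as a constant term -/

/-- The pairs of sets of colored integers below `N` that enumerate the colored Frobenius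
partitions of `n`. -/
def frobeniusPairs (k N n : ℕ) : Finset (Finset (ColoredNat k) × Finset (ColoredNat k)) :=
  let s : Finset (ColoredNat k) := (range N ×ˢ univ).map toLex.toEmbedding
  {p ∈ s.powerset ×ˢ s.powerset | p.1.card = p.2.card ∧
    n = p.1.card + (∑ c ∈ p.1, c.val + ∑ c ∈ p.2, c.val)}

theorem mem_map_toLex_range {k N : ℕ} {c : ColoredNat k} :
    c ∈ (range N ×ˢ (univ : Finset (Fin k))).map toLex.toEmbedding ↔ c.val < N := by
  simp only [mem_map, mem_product, mem_range, mem_univ, and_true]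
  constructor
  · rintro ⟨a, ha, rfl⟩
    exact ha
  · intro h
    exact ⟨ofLex c, h, rfl⟩

theorem cphi_eq_card_frobeniusPairs {k N n : ℕ} (h : n < N) :
    cphi k n = (frobeniusPairs k N n).card := by
  have nodup {l : List (ColoredNat k)} (hl : l.Pairwise (fun x y => y < x)) : l.Nodup :=
    hl.imp fun h => h.ne'
  have sum_eq {l : List (ColoredNat k)} (hl : l.Pairwise (fun x y => y < x)) :
      ∑ c ∈ l.toFinset, c.val = (l.map ColoredNat.val).sum := List.sum_toFinset _ (nodup hl)
  have inj {l l' : List (ColoredNat k)} (hl : l.Pairwise (fun x y => y < x))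
      (hl' : l'.Pairwise (fun x y => y < x)) (e : l.toFinset = l'.toFinset) : l = l' :=
    (List.perm_of_nodup_nodup_toFinset_eq (nodup hl) (nodup hl') e).eq_of_pairwise
      (fun a b _ _ h1 h2 => absurd h1 h2.asymm) hl hl'
  rw [cphi, ← Set.ncard_coe_finset]
  refine Set.ncard_congr (fun p _ => (p.1.toFinset, p.2.toFinset)) ?_ ?_ ?_
  · rintro ⟨a, b⟩ ⟨h1, h2, h3, h4⟩
    simp only at h1 h2 h3 h4
    have bound {l : List (ColoredNat k)} (hl : (l.map ColoredNat.val).sum ≤ n) :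
        l.toFinset ⊆ (range N ×ˢ (univ : Finset (Fin k))).map toLex.toEmbedding := by
      intro c hc
      rw [mem_map_toLex_range]
      have := List.single_le_sum (by simp) _ (List.mem_map_of_mem (f := ColoredNat.val)
        (List.mem_toFinset.1 hc))
      lia
    simp only [frobeniusPairs, coe_filter, Set.mem_ofPred_eq, mem_product, mem_powerset,
      List.toFinset_card_of_nodup (nodup h2), List.toFinset_card_of_nodup (nodup h3), sum_eq h2,
      sum_eq h3]
    exact ⟨⟨bound (by lia), bound (by lia)⟩, h1, h4⟩
  · rintro ⟨a, b⟩ ⟨a', b'⟩ ⟨_, h2, h3, _⟩ ⟨_, h2', h3', _⟩ e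
    simp only [Prod.mk.injEq] at e
    exact Prod.ext (inj h2 h2' e.1) (inj h3 h3' e.2)
  · rintro ⟨s, t⟩ hst
    simp only [frobeniusPairs, coe_filter, Set.mem_ofPred_eq, mem_product] at hst
    have hs := (sortedGT_sort s).pairwise
    have ht := (sortedGT_sort t).pairwise
    refine ⟨(s.sort (· ≥ ·), t.sort (· ≥ ·)), ⟨?_, hs, ht, ?_⟩, ?_⟩
    · simpa using hst.2.1
    · simp only [← sum_eq hs, ← sum_eq ht, sort_toFinset, length_sort]
      exact hst.2.2
    · simp only [sort_toFinset]

/-- The constant term of a Laurent polynomial over the complex power series. -/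
noncomputable def constTerm : LaurentPolynomial ℂ⟦X⟧ →ₗ[ℂ⟦X⟧] ℂ⟦X⟧ where
  toFun f := f.coeff 0
  map_add' f g := by simp
  map_smul' c f := by simp

theorem constTerm_C_mul (g : ℂ⟦X⟧) (f : LaurentPolynomial ℂ⟦X⟧) :
    constTerm (LaurentPolynomial.C g * f) = g * constTerm f := by
  rw [← LaurentPolynomial.smul_eq_C_mul, map_smul, smul_eq_mul]

theorem constTerm_T (m : ℤ) :
    constTerm (LaurentPolynomial.T m) = if m = 0 then 1 else 0 := by
  exact Finsupp.single_apply

/-- The coefficient embedding of integral power series in Laurent polynomials. -/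
noncomputable abbrev toLaurentSeries : ℤ⟦X⟧ →+* LaurentPolynomial ℂ⟦X⟧ :=
  LaurentPolynomial.C.comp toComplexSeries

/-- The unit `c T` of the ring of Laurent polynomials. -/
noncomputable def scaledT (c : ℂˣ) : (LaurentPolynomial ℂ⟦X⟧)ˣ where
  val := LaurentPolynomial.C (PowerSeries.C (c : ℂ)) * LaurentPolynomial.T 1
  inv := LaurentPolynomial.C (PowerSeries.C ((c⁻¹ : ℂˣ) : ℂ)) * LaurentPolynomial.T (-1)
  val_inv := by
    rw [mul_mul_mul_comm, ← LaurentPolynomial.T_add, ← map_mul, ← map_mul]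
    simp
  inv_val := by
    rw [mul_mul_mul_comm, ← LaurentPolynomial.T_add, ← map_mul, ← map_mul]
    simp

theorem val_scaledT_zpow (c : ℂˣ) (m : ℤ) :
    ((scaledT c ^ m : (LaurentPolynomial ℂ⟦X⟧)ˣ) : LaurentPolynomial ℂ⟦X⟧) =
      LaurentPolynomial.C (PowerSeries.C ((c ^ m : ℂˣ) : ℂ)) * LaurentPolynomial.T m := by
  obtain ⟨n, rfl | rfl⟩ := m.eq_nat_or_neg
  · rw [zpow_natCast, zpow_natCast, Units.val_pow_eq_pow_val, Units.val_pow_eq_pow_val]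
    simp [scaledT, mul_pow, LaurentPolynomial.T_pow]
  · rw [zpow_neg, zpow_natCast, zpow_neg, zpow_natCast, ← inv_pow, ← inv_pow,
      Units.val_pow_eq_pow_val, Units.val_pow_eq_pow_val]
    change (LaurentPolynomial.C (PowerSeries.C ((c⁻¹ : ℂˣ) : ℂ)) * LaurentPolynomial.T (-1)) ^ n = _
    rw [mul_pow, LaurentPolynomial.T_pow, mul_neg_one, map_pow, map_pow]

theorem val_scaledT (c : ℂˣ) : (scaledT c : LaurentPolynomial ℂ⟦X⟧) =
    LaurentPolynomial.C (PowerSeries.C (c : ℂ)) * LaurentPolynomial.T 1 := by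
  simpa using val_scaledT_zpow c 1

theorem val_scaledT_inv (c : ℂˣ) :
    (((scaledT c)⁻¹ : (LaurentPolynomial ℂ⟦X⟧)ˣ) : LaurentPolynomial ℂ⟦X⟧) =
      LaurentPolynomial.C (PowerSeries.C ((c⁻¹ : ℂˣ) : ℂ)) * LaurentPolynomial.T (-1) := by
  simpa using val_scaledT_zpow c (-1)

/-- Expanding the product chooses one set of colored integers for each row; the constant term forces
equal cardinalities. Entries below `N` suffice because `n < N`. -/
theorem coeff_constTerm_tripleProd_pow (k N n : ℕ) (h : n < N) :
    coeff n (constTerm (tripleProd (scaledT 1) (toLaurentSeries X) N N ^ k)) = cphi k n := by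
  set q : LaurentPolynomial ℂ⟦X⟧ := toLaurentSeries X with hq
  have hu : (scaledT 1 : LaurentPolynomial ℂ⟦X⟧) = LaurentPolynomial.T 1 := by
    simp [val_scaledT]
  have hu' : ((scaledT 1)⁻¹ : (LaurentPolynomial ℂ⟦X⟧)ˣ) =
      (LaurentPolynomial.T (-1) : LaurentPolynomial ℂ⟦X⟧) := by
    simp [val_scaledT_inv]
  set s : Finset (ColoredNat k) := (range N ×ˢ univ).map toLex.toEmbedding with hs
  have hprod (g : ℕ → LaurentPolynomial ℂ⟦X⟧) :
      (∏ i ∈ range N, (1 + g i)) ^ k = ∏ c ∈ s, (1 + g c.val) := by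
    rw [hs, prod_map, prod_product, ← prod_pow]
    refine prod_congr rfl fun i _ => ?_
    simp [ColoredNat.val]
  have hterm (t : Finset (ColoredNat k)) :
      ∏ c ∈ t, (LaurentPolynomial.T 1 * q ^ (c.val + 1)) =
        LaurentPolynomial.T t.card * q ^ (t.card + ∑ c ∈ t, c.val) := by
    rw [prod_mul_distrib, prod_const, LaurentPolynomial.T_pow, prod_pow_eq_pow_sum,
      sum_add_distrib, sum_const, smul_eq_mul, mul_one, mul_one, add_comm (∑ c ∈ t, c.val)]
  have hterm' (t : Finset (ColoredNat k)) :
      ∏ c ∈ t, (LaurentPolynomial.T (-1) * q ^ c.val) =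
        LaurentPolynomial.T (-t.card) * q ^ (∑ c ∈ t, c.val) := by
    rw [prod_mul_distrib, prod_const, LaurentPolynomial.T_pow, prod_pow_eq_pow_sum, mul_neg_one]
  rw [cphi_eq_card_frobeniusPairs h, tripleProd, mul_pow, hu, hu', hprod, hprod, prod_one_add,
    prod_one_add, sum_mul_sum, ← sum_product', map_sum, map_sum, frobeniusPairs, card_filter]
  push_cast
  refine sum_congr rfl fun p _ => ?_
  rw [hterm, hterm']
  have e : (LaurentPolynomial.T p.1.card : LaurentPolynomial ℂ⟦X⟧) *
      q ^ (p.1.card + ∑ c ∈ p.1, c.val) *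
      (LaurentPolynomial.T (-p.2.card) * q ^ (∑ c ∈ p.2, c.val)) =
      LaurentPolynomial.C (X ^ (p.1.card + (∑ c ∈ p.1, c.val + ∑ c ∈ p.2, c.val))) *
        LaurentPolynomial.T (p.1.card - p.2.card) := by
    have : q = LaurentPolynomial.C X := by simp [hq]
    rw [LaurentPolynomial.T_sub, map_pow, ← this]
    ring
  rw [e, constTerm_C_mul, constTerm_T, mul_ite, mul_one, mul_zero, ite_and]
  simp only [sub_eq_zero, Nat.cast_inj]
  split_ifs with _ h2
  · rw [coeff_X_pow, if_pos h2]
  · rw [coeff_X_pow, if_neg h2]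
  · simp

/-- The partial lattice sum `∑ c₁^{m₁} c₂^{m₂} c₃^{m₃} q^{(m₁² + m₂² + m₃²)/2}` over
`m₁ + m₂ + m₃ = 0`. -/
noncomputable def latticeSum (c₁ c₂ c₃ : ℂˣ) (N : ℕ) : ℂ⟦X⟧ :=
  ∑ m ∈ Icc (-N : ℤ) N ×ˢ Icc (-N : ℤ) N ×ˢ Icc (-N : ℤ) N with m.1 + m.2.1 + m.2.2 = 0,
    PowerSeries.C ((c₁ ^ m.1 * c₂ ^ m.2.1 * c₃ ^ m.2.2 : ℂˣ) : ℂ) *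
      X ^ (triangular m.1 + triangular m.2.1 + triangular m.2.2)

theorem constTerm_thetaSum_mul (c₁ c₂ c₃ : ℂˣ) (N : ℕ) :
    constTerm (thetaSum (scaledT c₁) (toLaurentSeries X) N *
      (thetaSum (scaledT c₂) (toLaurentSeries X) N *
        thetaSum (scaledT c₃) (toLaurentSeries X) N)) = latticeSum c₁ c₂ c₃ N := by
  simp only [thetaSum, latticeSum]
  rw [sum_mul_sum, ← sum_product', sum_mul_sum, ← sum_product', map_sum, sum_filter]
  refine sum_congr rfl fun m _ => ?_
  have e : ((scaledT c₁ ^ m.1 : (LaurentPolynomial ℂ⟦X⟧)ˣ) : LaurentPolynomial ℂ⟦X⟧) *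
      toLaurentSeries X ^ triangular m.1 *
      (((scaledT c₂ ^ m.2.1 : (LaurentPolynomial ℂ⟦X⟧)ˣ) : LaurentPolynomial ℂ⟦X⟧) *
      toLaurentSeries X ^ triangular m.2.1 *
      (((scaledT c₃ ^ m.2.2 : (LaurentPolynomial ℂ⟦X⟧)ˣ) : LaurentPolynomial ℂ⟦X⟧) *
      toLaurentSeries X ^ triangular m.2.2)) =
      LaurentPolynomial.C (PowerSeries.C ((c₁ ^ m.1 * c₂ ^ m.2.1 * c₃ ^ m.2.2 : ℂˣ) : ℂ) *
        X ^ (triangular m.1 + triangular m.2.1 + triangular m.2.2)) *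
        LaurentPolynomial.T (m.1 + m.2.1 + m.2.2) := by
    have : toLaurentSeries X = LaurentPolynomial.C X := by simp
    rw [val_scaledT_zpow, val_scaledT_zpow, val_scaledT_zpow, this, LaurentPolynomial.T_add,
      LaurentPolynomial.T_add]
    simp only [Units.val_mul, map_mul, map_pow, pow_add]
    ring
  rw [e, constTerm_C_mul, constTerm_T, mul_ite, mul_one, mul_zero]

/-! ### The two lattice sums -/

theorem X_pow_dvd_constTerm {N : ℕ} {f g : LaurentPolynomial ℂ⟦X⟧}
    (h : toLaurentSeries X ^ N ∣ f - g) : X ^ N ∣ constTerm f - constTerm g := by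
  obtain ⟨z, hz⟩ := h
  have : toLaurentSeries X ^ N = LaurentPolynomial.C (X ^ N) := by simp
  rw [← map_sub, hz, this, constTerm_C_mul]
  exact dvd_mul_right _ _

theorem mul_mul_mul_eq_cube_mul {S : Type*} [CommRing S] (x a b c : S) :
    x * a * (x * b * (x * c)) = x ^ 3 * (a * (b * c)) := by ring

theorem constTerm_mul_three (e : ℤ⟦X⟧) (a b c : LaurentPolynomial ℂ⟦X⟧) :
    constTerm (toLaurentSeries e * a * (toLaurentSeries e * b * (toLaurentSeries e * c))) =
      toComplexSeries e ^ 3 * constTerm (a * (b * c)) := by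
  rw [mul_mul_mul_eq_cube_mul, ← constTerm_C_mul, map_pow]
  rfl

theorem X_pow_dvd_mul_latticeSum_one (N : ℕ) :
    X ^ N ∣ toComplexSeries eulerSeries ^ 3 *
      constTerm (tripleProd (scaledT 1) (toLaurentSeries X) N N ^ 3) - latticeSum 1 1 1 N := by
  have h := pow_dvd_euler_mul_tripleProd_sub_thetaSum toLaurentSeries (scaledT 1) N
  have h' := X_pow_dvd_constTerm (dvd_mul_sub_mul h (dvd_mul_sub_mul h h))
  rwa [constTerm_thetaSum_mul, constTerm_mul_three, ← sq, ← pow_succ'] at h'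

theorem tripleProd_mul_cube_roots {S : Type*} [CommRing S] (u v w : Sˣ) (W : S)
    (hW : W ^ 2 + W + 1 = 0) (hv : (v : S) = W * u) (hw : (w : S) = W ^ 2 * u)
    (hv' : ((v⁻¹ : Sˣ) : S) = W ^ 2 * (u⁻¹ : Sˣ)) (hw' : ((w⁻¹ : Sˣ) : S) = W * (u⁻¹ : Sˣ))
    (q : S) (M N : ℕ) :
    tripleProd u q M N * (tripleProd v q M N * tripleProd w q M N) =
      tripleProd (u ^ 3) (q ^ 3) M N := by
  have key (Y : S) : (1 + Y) * ((1 + W * Y) * (1 + W ^ 2 * Y)) = 1 + Y ^ 3 := by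
    linear_combination (Y + W * Y ^ 2 + (W - 1) * Y ^ 3) * hW
  simp only [tripleProd]
  rw [mul_mul_mul_comm (∏ i ∈ range M, (1 + (v : S) * q ^ (i + 1))), mul_mul_mul_comm,
    ← prod_mul_distrib, ← prod_mul_distrib, ← prod_mul_distrib, ← prod_mul_distrib]
  congr 1 <;> refine prod_congr rfl fun i _ => ?_
  · rw [hv, hw, Units.val_pow_eq_pow_val, ← pow_mul, mul_comm 3, pow_mul, ← mul_pow, ← key]
    ring
  · rw [hv', hw', ← inv_pow, Units.val_pow_eq_pow_val, ← pow_mul, mul_comm 3, pow_mul, ← mul_pow,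
      ← key]
    ring

theorem constTerm_thetaSum_cube (N : ℕ) :
    constTerm (thetaSum (scaledT 1 ^ 3) (toLaurentSeries X ^ 3) N) = 1 := by
  rw [thetaSum, map_sum, sum_eq_single_of_mem 0 (by simp)]
  · have := constTerm_T 0
    rw [if_pos rfl, LaurentPolynomial.T_zero] at this
    simpa [triangular] using this
  · intro m _ hm
    rw [← zpow_natCast, ← zpow_mul, val_scaledT_zpow, one_zpow]
    have e : LaurentPolynomial.C (PowerSeries.C ((1 : ℂˣ) : ℂ)) *
        LaurentPolynomial.T ((3 : ℕ) * m) * (toLaurentSeries X ^ 3) ^ triangular m =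
        LaurentPolynomial.C ((X ^ 3) ^ triangular m) * LaurentPolynomial.T ((3 : ℕ) * m) := by
      have : toLaurentSeries X = LaurentPolynomial.C X := by simp
      rw [this, ← map_pow, ← map_pow, Units.val_one, map_one, map_one, one_mul, mul_comm]
    rw [e, constTerm_C_mul, constTerm_T, if_neg (by lia), mul_zero]

/-- The three twisted triple products multiply to a single one in `u³` and `q³`, whose theta sum has
only `m = 0` as constant term. -/
theorem X_pow_dvd_mul_latticeSum_cube_roots {ω : ℂˣ} (hω : (ω : ℂ) ^ 2 + ω + 1 = 0) (N : ℕ) :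
    X ^ N ∣ toComplexSeries (dilate eulerSeries) * latticeSum 1 ω (ω ^ 2) N -
      toComplexSeries eulerSeries ^ 3 := by
  have h3 : ω ^ 3 = 1 := Units.ext (by simpa using cube_root_pow_three hω)
  have hinv : ω⁻¹ = ω ^ 2 := inv_eq_of_mul_eq_one_right (by rw [← pow_succ', h3])
  have hinv' : (ω ^ 2)⁻¹ = ω := inv_eq_of_mul_eq_one_right (by rw [← pow_succ, h3])
  set W : LaurentPolynomial ℂ⟦X⟧ := LaurentPolynomial.C (PowerSeries.C (ω : ℂ)) with hWdef
  have hW : W ^ 2 + W + 1 = 0 := by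
    rw [hWdef, ← map_pow, ← map_pow, ← map_add, ← map_add, ← map_one LaurentPolynomial.C,
      ← map_add, ← map_one PowerSeries.C, ← map_add, hω, map_zero, map_zero]
  have hprod := tripleProd_mul_cube_roots (scaledT 1) (scaledT ω) (scaledT (ω ^ 2)) W hW
    (by simp [val_scaledT, hWdef]) (by simp [val_scaledT, hWdef])
    (by rw [val_scaledT_inv, val_scaledT_inv, hinv]; simp [hWdef])
    (by rw [val_scaledT_inv, val_scaledT_inv, hinv']; simp [hWdef])
    (toLaurentSeries X) N N
  have h1 := X_pow_dvd_constTerm (dvd_mul_sub_mul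
    (pow_dvd_euler_mul_tripleProd_sub_thetaSum toLaurentSeries (scaledT 1) N)
    (dvd_mul_sub_mul (pow_dvd_euler_mul_tripleProd_sub_thetaSum toLaurentSeries (scaledT ω) N)
      (pow_dvd_euler_mul_tripleProd_sub_thetaSum toLaurentSeries (scaledT (ω ^ 2)) N)))
  have h2 := pow_dvd_euler_mul_tripleProd_sub_thetaSum
    (toLaurentSeries.comp (dilate (R := ℤ) : ℤ⟦X⟧ →+* ℤ⟦X⟧)) (scaledT 1 ^ 3) N
  have hX : (toLaurentSeries.comp (dilate (R := ℤ) : ℤ⟦X⟧ →+* ℤ⟦X⟧)) X =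
      toLaurentSeries X ^ 3 := by
    rw [RingHom.comp_apply, RingHom.coe_coe, dilate_X, map_pow]
  rw [hX, ← hprod, ← pow_mul] at h2
  have h2 := X_pow_dvd_constTerm ((pow_dvd_pow _ (by lia : N ≤ 3 * N)).trans h2)
  rw [constTerm_thetaSum_cube] at h2
  rw [constTerm_thetaSum_mul, constTerm_mul_three] at h1
  set P := constTerm (tripleProd (scaledT 1) (toLaurentSeries X) N N *
    (tripleProd (scaledT ω) (toLaurentSeries X) N N *
      tripleProd (scaledT (ω ^ 2)) (toLaurentSeries X) N N)) with hP
  have e2 : constTerm ((toLaurentSeries.comp (dilate (R := ℤ) : ℤ⟦X⟧ →+* ℤ⟦X⟧)) eulerSeries *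
      (tripleProd (scaledT 1) (toLaurentSeries X) N N *
      (tripleProd (scaledT ω) (toLaurentSeries X) N N *
      tripleProd (scaledT (ω ^ 2)) (toLaurentSeries X) N N))) =
      toComplexSeries (dilate eulerSeries) * P := by
    rw [hP, ← constTerm_C_mul]
    rfl
  rw [e2] at h2
  obtain ⟨x, hx⟩ := h1
  obtain ⟨y, hy⟩ := h2
  refine ⟨toComplexSeries eulerSeries ^ 3 * y - toComplexSeries (dilate eulerSeries) * x, ?_⟩
  linear_combination toComplexSeries eulerSeries ^ 3 * hy -
    toComplexSeries (dilate eulerSeries) * hx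

/-- The index set of `latticeSum`, cut down to the exponent `n`. -/
noncomputable def latticeSet (N n : ℕ) : Finset (ℤ × ℤ × ℤ) :=
  {m ∈ Icc (-N : ℤ) N ×ˢ Icc (-N : ℤ) N ×ˢ Icc (-N : ℤ) N | m.1 + m.2.1 + m.2.2 = 0 ∧
    n = triangular m.1 + triangular m.2.1 + triangular m.2.2}

theorem coeff_latticeSum (c₁ c₂ c₃ : ℂˣ) (N n : ℕ) : coeff n (latticeSum c₁ c₂ c₃ N) =
    ∑ m ∈ latticeSet N n, ((c₁ ^ m.1 * c₂ ^ m.2.1 * c₃ ^ m.2.2 : ℂˣ) : ℂ) := by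
  rw [latticeSum, map_sum, latticeSet, ← filter_filter, sum_filter (fun m : ℤ × ℤ × ℤ => n = _)]
  refine sum_congr rfl fun m _ => ?_
  rw [coeff_C_mul, coeff_X_pow, mul_ite, mul_one, mul_zero]

/-- Eliminating `m₁` leaves the form `m₂² + m₂m₃ + m₃²`. Thus `n` mod 3 tells whether 3 divides `m₂
- m₃`, the exponent of `ω` in the twisted sum. -/
theorem mem_latticeSet_mod_three {N n : ℕ} {m : ℤ × ℤ × ℤ} (h : m ∈ latticeSet N n) :
    (n : ℤ) = (m.2.1 - m.2.2) ^ 2 + 3 * (m.2.1 * m.2.2) := by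
  simp only [latticeSet, mem_filter] at h
  obtain ⟨-, h0, h1⟩ := h
  have e1 := two_mul_triangular m.1
  have e2 := two_mul_triangular m.2.1
  have e3 := two_mul_triangular m.2.2
  have h1' : (n : ℤ) = triangular m.1 + triangular m.2.1 + triangular m.2.2 := by
    exact_mod_cast h1
  rw [show m.1 = -m.2.1 - m.2.2 by lia] at e1 h1'
  linarith

theorem zpow_mul_zpow_sq {ω : ℂˣ} (h3 : ω ^ 3 = 1) (a b : ℤ) :
    ω ^ a * (ω ^ 2) ^ b = ω ^ (a - b) := by
  have : (ω ^ 2) ^ b = ω ^ (-b) * (ω ^ 3) ^ b := by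
    rw [← zpow_natCast, ← zpow_natCast, ← zpow_mul, ← zpow_mul, ← zpow_add]
    congr 1
    push_cast
    ring
  rw [this, h3, one_zpow, mul_one, ← zpow_add, sub_eq_add_neg]

theorem coeff_latticeSum_of_mod_eq_zero {ω : ℂˣ} (h3 : ω ^ 3 = 1) {N n : ℕ} (hn : n % 3 = 0) :
    coeff n (latticeSum 1 ω (ω ^ 2) N) = coeff n (latticeSum 1 1 1 N) := by
  rw [coeff_latticeSum, coeff_latticeSum]
  refine sum_congr rfl fun m hm => ?_
  have h := mem_latticeSet_mod_three hm
  have hd : (3 : ℤ) ∣ (m.2.1 - m.2.2) ^ 2 :=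
    ⟨n / 3 - m.2.1 * m.2.2, by have : (n : ℤ) = 3 * (n / 3) := by lia
                               linarith⟩
  obtain ⟨k, hk⟩ := Int.prime_three.dvd_of_dvd_pow hd
  rw [one_zpow, one_mul, zpow_mul_zpow_sq h3, hk, zpow_mul]
  have : ω ^ (3 : ℤ) = 1 := by exact_mod_cast h3
  simp [this]

theorem coeff_latticeSum_of_mod_eq_two (c₁ c₂ c₃ : ℂˣ) {N n : ℕ} (hn : n % 3 = 2) :
    coeff n (latticeSum c₁ c₂ c₃ N) = 0 := by
  rw [coeff_latticeSum]
  refine sum_eq_zero fun m hm => ?_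
  have h := mem_latticeSet_mod_three hm
  exfalso
  obtain ⟨k, hk⟩ | ⟨k, hk⟩ | ⟨k, hk⟩ : (∃ k, m.2.1 - m.2.2 = 3 * k) ∨
      (∃ k, m.2.1 - m.2.2 = 3 * k + 1) ∨ ∃ k, m.2.1 - m.2.2 = 3 * k + 2 := by
    have : (m.2.1 - m.2.2) % 3 = 0 ∨ (m.2.1 - m.2.2) % 3 = 1 ∨ (m.2.1 - m.2.2) % 3 = 2 := by lia
    rcases this with h | h | h
    · exact Or.inl ⟨(m.2.1 - m.2.2) / 3, by lia⟩
    · exact Or.inr (Or.inl ⟨(m.2.1 - m.2.2) / 3, by lia⟩)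
    · exact Or.inr (Or.inr ⟨(m.2.1 - m.2.2) / 3, by lia⟩)
  all_goals rw [hk] at h; ring_nf at h; lia

theorem coeff_latticeSum_of_mod_eq_one {ω : ℂˣ} (hω : (ω : ℂ) ^ 2 + ω + 1 = 0) {N n : ℕ}
    (hn : n % 3 = 1) :
    coeff n (latticeSum 1 1 1 N) = -2 * coeff n (latticeSum 1 ω (ω ^ 2) N) := by
  have h3 : ω ^ 3 = 1 := Units.ext (by simpa using cube_root_pow_three hω)
  have h3' : ω ^ (3 : ℤ) = 1 := by exact_mod_cast h3
  rw [coeff_latticeSum, coeff_latticeSum]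
  -- Exchanging `m₂` and `m₃` replaces `ω^d` by `ω^(-d)`. For `3 ∤ d` the two add to `-1`, whence
  -- the factor `-2`.
  have hswap : ∑ m ∈ latticeSet N n, ((1 ^ m.1 * ω ^ m.2.1 * (ω ^ 2) ^ m.2.2 : ℂˣ) : ℂ) =
      ∑ m ∈ latticeSet N n, ((1 ^ m.1 * ω ^ m.2.2 * (ω ^ 2) ^ m.2.1 : ℂˣ) : ℂ) := by
    refine sum_nbij' (fun m => (m.1, m.2.2, m.2.1)) (fun m => (m.1, m.2.2, m.2.1)) ?_ ?_ ?_ ?_ ?_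
    · intro m hm
      simp only [latticeSet, mem_filter, mem_product] at hm ⊢
      obtain ⟨⟨h1, h2, h3⟩, h4, h5⟩ := hm
      exact ⟨⟨h1, h3, h2⟩, by lia, by lia⟩
    · intro m hm
      simp only [latticeSet, mem_filter, mem_product] at hm ⊢
      obtain ⟨⟨h1, h2, h3⟩, h4, h5⟩ := hm
      exact ⟨⟨h1, h3, h2⟩, by lia, by lia⟩
    all_goals intros; rfl
  rw [neg_mul, two_mul]
  nth_rw 2 [hswap]
  rw [← sum_add_distrib, ← sum_neg_distrib]
  refine sum_congr rfl fun m hm => ?_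
  have h := mem_latticeSet_mod_three hm
  simp only [one_zpow, one_mul, zpow_mul_zpow_sq h3]
  have hsq : ((ω ^ (2 : ℤ) : ℂˣ) : ℂ) = (ω : ℂ) ^ 2 := by norm_cast
  obtain ⟨k, hk⟩ | ⟨k, hk⟩ | ⟨k, hk⟩ : (∃ k, m.2.1 - m.2.2 = 3 * k) ∨
      (∃ k, m.2.1 - m.2.2 = 3 * k + 1) ∨ ∃ k, m.2.1 - m.2.2 = 3 * k - 1 := by
    have : (m.2.1 - m.2.2) % 3 = 0 ∨ (m.2.1 - m.2.2) % 3 = 1 ∨ (m.2.1 - m.2.2) % 3 = 2 := by lia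
    rcases this with h | h | h
    · exact Or.inl ⟨(m.2.1 - m.2.2) / 3, by lia⟩
    · exact Or.inr (Or.inl ⟨(m.2.1 - m.2.2) / 3, by lia⟩)
    · exact Or.inr (Or.inr ⟨(m.2.1 - m.2.2) / 3 + 1, by lia⟩)
  · exfalso
    rw [hk] at h; ring_nf at h; lia
  · rw [show m.2.2 - m.2.1 = 3 * (-k - 1) + 2 by lia, hk, zpow_add, zpow_add, zpow_mul, zpow_mul,
      h3', one_zpow, one_zpow, one_mul, one_mul, hsq, zpow_one, Units.val_one]
    linear_combination hω
  · rw [show m.2.2 - m.2.1 = 3 * (-k) + 1 by lia, hk, show 3 * k - 1 = 3 * (k - 1) + 2 by ring,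
      zpow_add, zpow_add, zpow_mul, zpow_mul,
      h3', one_zpow, one_zpow, one_mul, one_mul, hsq, zpow_one, Units.val_one]
    linear_combination hω

/-! ### The generating function of `cφ₃` -/

/-- `1 / (q; q)_∞`. -/
noncomputable def eulerInv : ℤ⟦X⟧ := invOfUnit eulerSeries 1

theorem eulerSeries_mul_eulerInv : eulerSeries * eulerInv = 1 :=
  mul_invOfUnit _ _ (by simp [constantCoeff_eulerSeries])

theorem dilate_eulerSeries_mul_eulerInv : dilate eulerSeries * dilate eulerInv = 1 := by
  rw [← map_mul, eulerSeries_mul_eulerInv, map_one]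

/-- The generating function of the number of `k`-colored Frobenius partitions. -/
noncomputable def cphiSeries (k : ℕ) : ℤ⟦X⟧ := mk fun n => (cphi k n : ℤ)

theorem X_pow_dvd_cphiSeries_three (N : ℕ) :
    X ^ N ∣ toComplexSeries (eulerSeries ^ 3 * cphiSeries 3) - latticeSum 1 1 1 N := by
  have h1 := X_pow_dvd_mul_latticeSum_one N
  have h2 : X ^ N ∣ toComplexSeries (cphiSeries 3) -
      constTerm (tripleProd (scaledT 1) (toLaurentSeries X) N N ^ 3) := by
    rw [X_pow_dvd_iff]
    intro m hm
    rw [map_sub, coeff_constTerm_tripleProd_pow 3 N m hm]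
    simp [cphiSeries]
  convert! dvd_add (Dvd.dvd.mul_left h2 (toComplexSeries eulerSeries ^ 3)) h1 using 1
  rw [map_mul, map_pow]
  ring

theorem X_pow_dvd_eulerSeries_cube_div (N : ℕ) {ω : ℂˣ} (hω : (ω : ℂ) ^ 2 + ω + 1 = 0) :
    X ^ N ∣ toComplexSeries (eulerSeries ^ 3 * dilate eulerInv) - latticeSum 1 ω (ω ^ 2) N := by
  have h1 := Dvd.dvd.mul_left (X_pow_dvd_mul_latticeSum_cube_roots hω N)
    (-toComplexSeries (dilate eulerInv))
  convert! h1 using 1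
  have h2 := congrArg toComplexSeries dilate_eulerSeries_mul_eulerInv
  rw [map_mul, map_one] at h2
  rw [map_mul, map_pow]
  linear_combination latticeSum 1 ω (ω ^ 2) N * h2

theorem coeff_X_mul_dilate_of_mod_ne_one {R : Type*} [CommRing R] (f : R⟦X⟧) {n : ℕ}
    (hn : n % 3 ≠ 1) : coeff n (X * dilate f) = 0 := by
  rcases n with _ | n
  · simp
  · rw [coeff_succ_X_mul, coeff_expand_of_not_dvd _ _ _ (by lia)]

theorem coeff_dilate_of_mod_ne_zero {R : Type*} [CommRing R] (f : R⟦X⟧) {n : ℕ}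
    (hn : n % 3 ≠ 0) : coeff n (dilate f) = 0 :=
  coeff_expand_of_not_dvd _ _ _ (by lia)

/-- The numerator `(q; q)_∞³ / (q³; q³)_∞ + 9 q (q⁹; q⁹)_∞³ / (q³; q³)_∞` of the generating
function of `cφ₃`, which is the cubic theta function of the Borweins. -/
noncomputable def cubicTheta : ℤ⟦X⟧ :=
  dilate eulerInv * (eulerSeries ^ 3 + 9 * (X * dilate (dilate eulerSeries) ^ 3))

/-- The twisted sum is `p(q³) - 3q r(q³)`. The untwisted one has the same part in exponents `0` mod
3 and `-2` times the part in exponents `1` mod 3, hence equals `p(q³) + 6q r(q³)`. -/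
theorem eulerSeries_cube_mul_cphiSeries : eulerSeries ^ 3 * cphiSeries 3 = cubicTheta := by
  obtain ⟨A, hA⟩ := exists_eulerSeries_cube_eq
  obtain ⟨ω, hω⟩ := exists_cube_root
  have hω0 : ω ≠ 0 := by rintro rfl; norm_num at hω
  obtain ⟨ω, rfl⟩ := isUnit_iff_ne_zero.2 hω0
  have h3 : ω ^ 3 = 1 := Units.ext (by simpa using cube_root_pow_three hω)
  set p := eulerInv * A with hp
  set r := eulerInv * dilate eulerSeries ^ 3 with hr
  have hb : eulerSeries ^ 3 * dilate eulerInv = dilate p - 3 * (X * dilate r) := by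
    rw [hA, hp, hr]
    simp only [map_mul, map_pow]
    ring
  have ha : cubicTheta = dilate p + 6 * (X * dilate r) := by
    rw [cubicTheta, hA, hp, hr]
    simp only [map_mul, map_pow]
    ring
  ext n
  have ca := coeff_eq_of_X_pow_dvd_sub (X_pow_dvd_cphiSeries_three (n + 1)) (Nat.lt_succ_self n)
  have cb := coeff_eq_of_X_pow_dvd_sub (X_pow_dvd_eulerSeries_cube_div (n + 1) hω)
    (Nat.lt_succ_self n)
  rw [coeff_map, eq_intCast] at ca cb
  rw [hb] at cb
  have h3c (f : ℤ⟦X⟧) : coeff n (3 * f) = 3 * coeff n f := by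
    rw [← map_ofNat C, coeff_C_mul]
  have h6c (f : ℤ⟦X⟧) : coeff n (6 * f) = 6 * coeff n f := by
    rw [← map_ofNat C, coeff_C_mul]
  rw [ha, map_add, h6c]
  rw [map_sub, h3c] at cb
  have hn : n % 3 = 0 ∨ n % 3 = 1 ∨ n % 3 = 2 := by lia
  rcases hn with hn | hn | hn
  · rw [coeff_X_mul_dilate_of_mod_ne_one _ (by lia)] at cb ⊢
    rw [coeff_latticeSum_of_mod_eq_zero h3 hn, ← ca] at cb
    have : coeff n (dilate p) - 3 * 0 = coeff n (eulerSeries ^ 3 * cphiSeries 3) := by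
      exact_mod_cast cb
    lia
  · rw [coeff_dilate_of_mod_ne_zero _ (by lia)] at cb ⊢
    rw [coeff_latticeSum_of_mod_eq_one hω hn, ← cb] at ca
    have : coeff n (eulerSeries ^ 3 * cphiSeries 3) = -2 * (0 - 3 * coeff n (X * dilate r)) := by
      exact_mod_cast ca
    lia
  · rw [coeff_dilate_of_mod_ne_zero _ (by lia), coeff_X_mul_dilate_of_mod_ne_one _ (by lia)]
    rw [coeff_latticeSum_of_mod_eq_two _ _ _ hn] at ca
    have : coeff n (eulerSeries ^ 3 * cphiSeries 3) = 0 := by exact_mod_cast ca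
    lia

theorem cphiSeries_three_eq : cphiSeries 3 = cubicTheta * eulerInv ^ 3 := by
  have h : (eulerSeries * eulerInv) ^ 3 = 1 := by rw [eulerSeries_mul_eulerInv, one_pow]
  rw [← eulerSeries_cube_mul_cphiSeries]
  linear_combination -cphiSeries 3 * h

/-! ### Modular functions of levels three and nine -/

/-- `q (q⁹; q⁹)_∞³`. -/
noncomputable def thetaNine : ℤ⟦X⟧ := X * dilate (dilate eulerSeries) ^ 3

/-- The hauptmodul `q (q⁹; q⁹)_∞³ / (q; q)_∞³` of level nine. -/
noncomputable def hauptNine : ℤ⟦X⟧ := thetaNine * eulerInv ^ 3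

/-- The hauptmodul `q (q³; q³)_∞¹² / (q; q)_∞¹²` of level three. -/
noncomputable def hauptThree : ℤ⟦X⟧ := X * dilate eulerSeries ^ 12 * eulerInv ^ 12

theorem hauptThree_eq : hauptThree = hauptNine + 9 * hauptNine ^ 2 + 27 * hauptNine ^ 3 := by
  have h : eulerSeries * eulerInv = 1 := eulerSeries_mul_eulerInv
  have h3 : eulerSeries ^ 3 * eulerInv ^ 3 = 1 := by rw [← mul_pow, h, one_pow]
  have h6 : eulerSeries ^ 6 * eulerInv ^ 6 = 1 := by rw [← mul_pow, h, one_pow]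
  have h9 : eulerSeries ^ 9 * eulerInv ^ 9 = 1 := by rw [← mul_pow, h, one_pow]
  rw [hauptThree, dilate_eulerSeries_pow_twelve, hauptNine, thetaNine]
  generalize eulerInv = D at *
  generalize eulerSeries = E at *
  generalize dilate (dilate E) = F at *
  linear_combination (X * F ^ 3 * D ^ 3) * h9 + 9 * (X * F ^ 3) ^ 2 * D ^ 6 * h6 +
    27 * (X * F ^ 3) ^ 3 * D ^ 9 * h3

theorem hauptNine_pow_four : hauptNine ^ 4 = hauptThree * dilate hauptThree := by
  have h : (dilate eulerSeries * dilate eulerInv) ^ 12 = 1 := by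
    rw [dilate_eulerSeries_mul_eulerInv, one_pow]
  rw [hauptNine, hauptThree, thetaNine]
  simp only [map_mul, map_pow, dilate_X]
  linear_combination -X ^ 4 * dilate (dilate eulerSeries) ^ 12 * eulerInv ^ 12 * h

theorem hauptNine_ne_zero : hauptNine ≠ 0 := by
  intro h
  have h1 : hauptNine * eulerSeries ^ 3 = X * dilate (dilate eulerSeries) ^ 3 := by
    have : (eulerSeries * eulerInv) ^ 3 = 1 := by rw [eulerSeries_mul_eulerInv, one_pow]
    rw [hauptNine, thetaNine]
    linear_combination X * dilate (dilate eulerSeries) ^ 3 * this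
  rw [h, zero_mul] at h1
  have h2 := congrArg (coeff 1) h1
  rw [show (1 : ℕ) = 0 + 1 from rfl, coeff_succ_X_mul, coeff_zero_eq_constantCoeff_apply] at h2
  simp [constantCoeff_eulerSeries] at h2

/-- A cubic equation for `w` with coefficients in the image of `dilate`, along which `extract` is
linear; it is the source of the recurrence for `extractPoly`. -/
theorem hauptNine_cube : hauptNine ^ 3 =
    dilate hauptThree * (1 + 9 * hauptNine + 27 * hauptNine ^ 2) := by
  have h := hauptNine_pow_four
  have h' : hauptNine * hauptNine ^ 3 =
      hauptNine * (dilate hauptThree * (1 + 9 * hauptNine + 27 * hauptNine ^ 2)) := by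
    linear_combination h + dilate hauptThree * hauptThree_eq
  exact mul_left_cancel₀ hauptNine_ne_zero h'

theorem constantCoeff_dilate (f : ℤ⟦X⟧) : constantCoeff (dilate f) = constantCoeff f :=
  constantCoeff_expand _ _ _

theorem eq_of_cube_eq {f g : ℤ⟦X⟧} (h : f ^ 3 = g ^ 3) (hf : constantCoeff f = 1)
    (hg : constantCoeff g = 1) : f = g := by
  have h1 : (f - g) * (f ^ 2 + f * g + g ^ 2) = 0 := by linear_combination h
  rcases mul_eq_zero.1 h1 with h2 | h2
  · exact sub_eq_zero.1 h2
  · have := congrArg constantCoeff h2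
    simp [hf, hg] at this

/-- The trisection `(q; q)_∞³ = (q³; q³)_∞ a(q³) - 3 q (q⁹; q⁹)_∞³`. -/
theorem eulerSeries_cube_eq : eulerSeries ^ 3 =
    dilate (eulerSeries * cubicTheta) - 3 * thetaNine := by
  obtain ⟨A, hA⟩ := exists_eulerSeries_cube_eq
  suffices h : A = eulerSeries * cubicTheta by
    rw [← h, hA, thetaNine]; ring
  have hD : (dilate eulerSeries * dilate eulerInv) ^ 3 = 1 := by
    rw [dilate_eulerSeries_mul_eulerInv, one_pow]
  have hd {f g : ℤ⟦X⟧} (h : dilate f = dilate g) : f = g := by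
    rw [← extract_dilate f, h, extract_dilate]
  have h12 := dilate_eulerSeries_pow_twelve
  have hc := congrArg constantCoeff hA
  simp only [map_sub, map_mul, map_pow, constantCoeff_X, constantCoeff_dilate,
    constantCoeff_eulerSeries] at hc
  have hcD := congrArg constantCoeff eulerSeries_mul_eulerInv
  rw [map_mul, constantCoeff_eulerSeries, one_mul, map_one] at hcD
  have hB : dilate A = eulerSeries ^ 3 + 3 * thetaNine := by rw [hA, thetaNine]; ring
  rw [← thetaNine] at h12
  -- Both candidates have the same cube, namely `(E¹² + 27 q E(q³)¹²) / E(q³)³`, and constant term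
  -- 1. For `A` this is the degree-twelve identity with `dilate` cancelled; for `E a` it is that
  -- identity itself.
  refine eq_of_cube_eq ?_ (by simpa using hc.symm) ?_
  swap
  · simp [cubicTheta, constantCoeff_eulerSeries, hcD]
  have hA3 : A ^ 3 * dilate eulerSeries ^ 3 =
      eulerSeries ^ 12 + 27 * X * dilate eulerSeries ^ 12 := by
    apply hd
    have e : thetaNine ^ 3 = X ^ 3 * dilate (dilate eulerSeries) ^ 9 := by rw [thetaNine]; ring
    simp only [map_mul, map_pow, map_add, map_ofNat, dilate_X]
    rw [hB, h12]
    linear_combination 27 * dilate (dilate eulerSeries) ^ 3 * e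
  have hX : X * dilate (dilate eulerSeries) ^ 3 = thetaNine := rfl
  have key : (eulerSeries * (eulerSeries ^ 3 + 9 * thetaNine)) ^ 3 =
      eulerSeries ^ 12 + 27 * X * dilate eulerSeries ^ 12 := by
    rw [h12]
    linear_combination -27 * (eulerSeries ^ 9 + 9 * thetaNine * eulerSeries ^ 6 +
        27 * thetaNine ^ 2 * eulerSeries ^ 3) * hX
  have e : (eulerSeries * cubicTheta) ^ 3 =
      dilate eulerInv ^ 3 * (eulerSeries * (eulerSeries ^ 3 + 9 * thetaNine)) ^ 3 := by
    rw [cubicTheta, thetaNine]; ring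
  rw [e, key, ← hA3]
  linear_combination -A ^ 3 * hD

/-! ### The action of `extract` on powers of the hauptmodul of level nine -/

theorem thetaNine_eq_mul_hauptNine : thetaNine = eulerSeries ^ 3 * hauptNine := by
  have h : (eulerSeries * eulerInv) ^ 3 = 1 := by rw [eulerSeries_mul_eulerInv, one_pow]
  rw [hauptNine]
  linear_combination -thetaNine * h

theorem cubicTheta_eq : cubicTheta =
    dilate eulerInv * (dilate (eulerSeries * cubicTheta) + 6 * thetaNine) := by
  have h := eulerSeries_cube_eq
  nth_rw 1 [cubicTheta]
  rw [← thetaNine]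
  linear_combination dilate eulerInv * h

theorem dilate_injective : Function.Injective (dilate (R := ℤ)) := by
  intro f g h
  rw [← extract_dilate f, h, extract_dilate]

/-- The norm `(q; q)_∞¹² / (q³; q³)_∞³` of `(q; q)_∞³`, written in the variable `q`. -/
noncomputable def cubeNorm : ℤ⟦X⟧ := eulerSeries ^ 12 * dilate eulerInv ^ 3

theorem cubeNorm_ne_zero : cubeNorm ≠ 0 := by
  have hE : eulerSeries ≠ 0 := left_ne_zero_of_mul_eq_one eulerSeries_mul_eulerInv
  have hD : dilate eulerInv ≠ 0 := right_ne_zero_of_mul_eq_one dilate_eulerSeries_mul_eulerInv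
  exact mul_ne_zero (pow_ne_zero _ hE) (pow_ne_zero _ hD)

theorem thetaNine_cube : thetaNine ^ 3 = dilate (hauptThree * cubeNorm) := by
  have h : (dilate eulerSeries * dilate eulerInv) ^ 12 = 1 := by
    rw [dilate_eulerSeries_mul_eulerInv, one_pow]
  have h' : (dilate (dilate eulerSeries) * dilate (dilate eulerInv)) ^ 3 = 1 := by
    rw [← map_mul, dilate_eulerSeries_mul_eulerInv, map_one, one_pow]
  rw [thetaNine, hauptThree, cubeNorm]
  simp only [map_mul, map_pow, dilate_X]
  generalize dilate eulerSeries = e at *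
  generalize dilate eulerInv = d at *
  linear_combination -X ^ 3 * dilate e ^ 9 * h -
    X ^ 3 * dilate e ^ 9 * (e * d) ^ 12 * h'

theorem dilate_cubeNorm : dilate cubeNorm =
    dilate (eulerSeries * cubicTheta) ^ 3 - 27 * thetaNine ^ 3 := by
  have h' : (dilate (dilate eulerSeries) * dilate (dilate eulerInv)) ^ 3 = 1 := by
    rw [← map_mul, dilate_eulerSeries_mul_eulerInv, map_one, one_pow]
  have h := dilate_eulerSeries_pow_twelve
  rw [← thetaNine] at h
  have hB : dilate (eulerSeries * cubicTheta) = eulerSeries ^ 3 + 3 * thetaNine := by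
    rw [eulerSeries_cube_eq]; ring
  rw [hB, cubeNorm, map_mul, map_pow, map_pow, h]
  linear_combination (eulerSeries ^ 9 + 9 * thetaNine * eulerSeries ^ 6 +
    27 * thetaNine ^ 2 * eulerSeries ^ 3) * h'

theorem cubeNorm_eq : cubeNorm = (eulerSeries * cubicTheta) ^ 3 - 27 * (hauptThree * cubeNorm) := by
  apply dilate_injective
  rw [map_sub, map_mul, map_pow, map_ofNat, ← thetaNine_cube]
  exact dilate_cubeNorm

/-- Rationalizes `w = θ / (B - 3θ)`: multiplying by `B² + 3Bθ + 9θ²` makes the denominator a series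
in `q³`, so `extract` can be read off from powers of `θ`. -/
theorem dilate_cubeNorm_mul_hauptNine : dilate cubeNorm * hauptNine =
    thetaNine * (dilate (eulerSeries * cubicTheta) ^ 2 +
      3 * dilate (eulerSeries * cubicTheta) * thetaNine + 9 * thetaNine ^ 2) := by
  have h := thetaNine_eq_mul_hauptNine
  have hB : dilate (eulerSeries * cubicTheta) = eulerSeries ^ 3 + 3 * thetaNine := by
    rw [eulerSeries_cube_eq]; ring
  rw [dilate_cubeNorm, hB]
  linear_combination -(eulerSeries ^ 6 + 9 * thetaNine * eulerSeries ^ 3 + 27 * thetaNine ^ 2) * h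

theorem extract_dilate_add {R : Type*} [CommRing R] (f g h : R⟦X⟧) :
    extract (dilate f + X * dilate g + X ^ 2 * dilate h) = f := by
  rw [map_add, map_add, extract_dilate, extract_X_mul_dilate, extract_X_sq_mul_dilate, add_zero,
    add_zero]

theorem extract_cubicTheta : extract cubicTheta = cubicTheta := by
  have h : cubicTheta = dilate (eulerInv * (eulerSeries * cubicTheta)) +
      X * dilate (6 * eulerInv * dilate eulerSeries ^ 3) + X ^ 2 * dilate 0 := by
    nth_rw 1 [cubicTheta_eq]
    rw [thetaNine]
    simp only [map_mul, map_pow, map_ofNat, map_zero]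
    ring
  rw [h, extract_dilate_add, ← h, ← mul_assoc, mul_comm eulerInv, eulerSeries_mul_eulerInv,
    one_mul]

theorem extract_hauptNine : extract hauptNine = 9 * hauptThree := by
  apply mul_left_cancel₀ cubeNorm_ne_zero
  rw [← extract_dilate_mul, dilate_cubeNorm_mul_hauptNine]
  have h : thetaNine * (dilate (eulerSeries * cubicTheta) ^ 2 +
      3 * dilate (eulerSeries * cubicTheta) * thetaNine + 9 * thetaNine ^ 2) =
      dilate (9 * (hauptThree * cubeNorm)) +
      X * dilate ((eulerSeries * cubicTheta) ^ 2 * dilate eulerSeries ^ 3) +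
      X ^ 2 * dilate (3 * (eulerSeries * cubicTheta) * dilate eulerSeries ^ 6) := by
    rw [map_mul dilate 9, ← thetaNine_cube, thetaNine]
    simp only [map_mul, map_pow, map_ofNat]
    ring
  rw [h, extract_dilate_add]
  ring

theorem extract_cubicTheta_mul_hauptNine :
    extract (cubicTheta * hauptNine) = cubicTheta * (27 * hauptThree) := by
  apply mul_left_cancel₀ cubeNorm_ne_zero
  rw [← extract_dilate_mul]
  set A := eulerSeries * cubicTheta with hA
  set s := hauptThree * cubeNorm with hs
  have h : dilate cubeNorm * (cubicTheta * hauptNine) =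
      dilate (eulerInv * (27 * A * s)) +
      X * dilate (eulerInv * (A ^ 3 + 54 * s) * dilate eulerSeries ^ 3) +
      X ^ 2 * dilate (eulerInv * (9 * A ^ 2) * dilate eulerSeries ^ 6) := by
    rw [mul_left_comm, dilate_cubeNorm_mul_hauptNine, ← hA, cubicTheta_eq, ← hA]
    simp only [map_mul, map_pow, map_ofNat, map_add]
    rw [hs, ← thetaNine_cube, thetaNine]
    ring
  rw [h, extract_dilate_add, hs, hA]
  linear_combination 27 * cubicTheta * hauptThree * cubeNorm * eulerSeries_mul_eulerInv

theorem extract_cubicTheta_mul_hauptNine_sq :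
    extract (cubicTheta * hauptNine ^ 2) =
      cubicTheta * (12 * hauptThree + 729 * hauptThree ^ 2) := by
  apply mul_left_cancel₀ (pow_ne_zero 2 cubeNorm_ne_zero)
  rw [← extract_dilate_mul]
  have hn := cubeNorm_eq
  set A := eulerSeries * cubicTheta with hA
  set s := hauptThree * cubeNorm with hs
  have h : dilate (cubeNorm ^ 2) * (cubicTheta * hauptNine ^ 2) =
      dilate (eulerInv * (12 * A ^ 4 * s + 405 * A * s ^ 2)) +
      X * dilate (eulerInv * (63 * A ^ 3 * s + 486 * s ^ 2) * dilate eulerSeries ^ 3) +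
      X ^ 2 * dilate (eulerInv * (A ^ 5 + 216 * A ^ 2 * s) * dilate eulerSeries ^ 6) := by
    rw [map_pow, mul_left_comm, ← mul_pow, dilate_cubeNorm_mul_hauptNine, ← hA, cubicTheta_eq,
      ← hA]
    simp only [map_mul, map_pow, map_ofNat, map_add]
    rw [hs, ← thetaNine_cube, thetaNine]
    ring
  rw [h, extract_dilate_add]
  -- `cubeNorm_eq` reads `A³ = cubeNorm + 27 s`, and `12 · 27 + 405 = 729`.
  have e : 12 * A ^ 4 * s + 405 * A * s ^ 2 = A * (12 * cubeNorm * s + 729 * s ^ 2) := by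
    linear_combination -12 * A * s * hn
  rw [e, hs, hA]
  linear_combination cubicTheta * cubeNorm ^ 2 * (12 * hauptThree + 729 * hauptThree ^ 2) *
    eulerSeries_mul_eulerInv

/-- The polynomials `Vᵢ` with `U (a wⁱ) = a Vᵢ(t)`, for `U` the extraction operator. -/
noncomputable def extractPoly : ℕ → Polynomial ℤ
  | 0 => 1
  | 1 => 27 * Polynomial.X
  | 2 => 12 * Polynomial.X + 729 * Polynomial.X ^ 2
  | i + 3 => Polynomial.X * (27 * extractPoly (i + 2) + 9 * extractPoly (i + 1) + extractPoly i)

theorem extract_cubicTheta_mul_hauptNine_pow (i : ℕ) :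
    extract (cubicTheta * hauptNine ^ i) =
      cubicTheta * Polynomial.aeval hauptThree (extractPoly i) := by
  induction i using extractPoly.induct with
  | case1 => simp [extractPoly, extract_cubicTheta]
  | case2 => simpa [extractPoly, map_ofNat] using extract_cubicTheta_mul_hauptNine
  | case3 => simpa [extractPoly, map_ofNat] using extract_cubicTheta_mul_hauptNine_sq
  | case4 i ih2 ih1 ih0 =>
    have h : cubicTheta * hauptNine ^ (i + 3) = dilate hauptThree *
        (cubicTheta * hauptNine ^ i + (9 : ℤ) • (cubicTheta * hauptNine ^ (i + 1)) +
          (27 : ℤ) • (cubicTheta * hauptNine ^ (i + 2))) := by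
      rw [pow_add, hauptNine_cube]
      simp only [zsmul_eq_mul]
      push_cast
      ring
    rw [h, extract_dilate_mul, map_add, map_add, map_smul, map_smul, ih2, ih1, ih0]
    simp only [extractPoly, map_mul, map_add, map_ofNat, Polynomial.aeval_X, zsmul_eq_mul]
    push_cast
    ring

/-- The linear extension `p ↦ ∑ pᵢ Vᵢ`. -/
noncomputable def extractPolyLin (p : Polynomial ℤ) : Polynomial ℤ :=
  p.sum fun i c => Polynomial.C c * extractPoly i

theorem extractPolyLin_add (p q : Polynomial ℤ) :
    extractPolyLin (p + q) = extractPolyLin p + extractPolyLin q :=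
  Polynomial.sum_add_index _ _ _ (by simp) (by intros; rw [map_add, add_mul])

theorem extractPolyLin_C_mul_X_pow (c : ℤ) (i : ℕ) :
    extractPolyLin (Polynomial.C c * Polynomial.X ^ i) = Polynomial.C c * extractPoly i := by
  rw [extractPolyLin, Polynomial.C_mul_X_pow_eq_monomial, Polynomial.sum_monomial_index]
  simp

theorem extractPolyLin_C_mul (c : ℤ) (p : Polynomial ℤ) :
    extractPolyLin (Polynomial.C c * p) = Polynomial.C c * extractPolyLin p := by
  induction p using Polynomial.induction_on' with
  | add p q hp hq => rw [mul_add, extractPolyLin_add, extractPolyLin_add, hp, hq, mul_add]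
  | monomial n a =>
    rw [← Polynomial.C_mul_X_pow_eq_monomial, ← mul_assoc, ← map_mul, extractPolyLin_C_mul_X_pow,
      extractPolyLin_C_mul_X_pow, map_mul, mul_assoc]

theorem extract_cubicTheta_mul_aeval (p : Polynomial ℤ) :
    extract (cubicTheta * Polynomial.aeval hauptNine p) =
      cubicTheta * Polynomial.aeval hauptThree (extractPolyLin p) := by
  induction p using Polynomial.induction_on' with
  | add p q hp hq => rw [map_add, mul_add, map_add, hp, hq, extractPolyLin_add, map_add, mul_add]
  | monomial n a =>
    have h : cubicTheta * Polynomial.aeval hauptNine (Polynomial.monomial n a) =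
        a • (cubicTheta * hauptNine ^ n) := by
      rw [Polynomial.aeval_monomial, zsmul_eq_mul, eq_intCast]
      ring
    rw [h, map_smul, extract_cubicTheta_mul_hauptNine_pow, ← Polynomial.C_mul_X_pow_eq_monomial,
      extractPolyLin_C_mul_X_pow, map_mul, Polynomial.aeval_C, zsmul_eq_mul,
      eq_intCast]
    ring

/-- The polynomial that expresses the hauptmodul of level three by that of level nine. -/
noncomputable def levelPoly : Polynomial ℤ :=
  Polynomial.X + 9 * Polynomial.X ^ 2 + 27 * Polynomial.X ^ 3

theorem aeval_hauptThree (p : Polynomial ℤ) :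
    Polynomial.aeval hauptThree p = Polynomial.aeval hauptNine (p.comp levelPoly) := by
  rw [Polynomial.aeval_comp]
  congr 1
  simp [levelPoly, hauptThree_eq, map_ofNat]

/-- Here `q E⁻³ = w E(q⁹)⁻³`: the extra `w` becomes the factor `Polynomial.X`, and `E(q⁹)⁻³` leaves
`extract` as `E(q³)⁻³`. -/
theorem extract_even (p : Polynomial ℤ) :
    extract (X * (eulerInv ^ 3 * cubicTheta * Polynomial.aeval hauptThree p)) =
      dilate eulerInv ^ 3 * cubicTheta *
        Polynomial.aeval hauptThree (extractPolyLin (Polynomial.X * p.comp levelPoly)) := by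
  have h' : (dilate (dilate eulerSeries) * dilate (dilate eulerInv)) ^ 3 = 1 := by
    rw [← map_mul, dilate_eulerSeries_mul_eulerInv, map_one, one_pow]
  rw [mul_assoc (dilate eulerInv ^ 3), ← extract_cubicTheta_mul_aeval, ← extract_dilate_mul,
    aeval_hauptThree]
  congr 1
  rw [map_mul, Polynomial.aeval_X]
  generalize Polynomial.aeval hauptNine (p.comp levelPoly) = z
  rw [hauptNine, thetaNine, map_pow]
  linear_combination (-X * eulerInv ^ 3 * cubicTheta * z) * h'

theorem extract_odd (p : Polynomial ℤ) :
    extract (dilate eulerInv ^ 3 * cubicTheta * Polynomial.aeval hauptThree p) =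
      eulerInv ^ 3 * cubicTheta *
        Polynomial.aeval hauptThree (extractPolyLin (p.comp levelPoly)) := by
  rw [mul_assoc (eulerInv ^ 3), ← extract_cubicTheta_mul_aeval, ← extract_dilate_mul,
    aeval_hauptThree, map_pow, mul_assoc]

/-! ### Divisibility by half-integral powers of three -/

/-- `c` is divisible by `3 ^ (m / 2)`, that is `m ≤ 2 v₃(c)`. -/
def HalfDvd (m c : ℤ) : Prop := (3 : ℤ) ^ ((m + 1) / 2).toNat ∣ c

theorem HalfDvd.mono {m m' c : ℤ} (h : HalfDvd m c) (hm : m' ≤ m) : HalfDvd m' c :=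
  (pow_dvd_pow _ (by lia)).trans h

theorem halfDvd_zero (m : ℤ) : HalfDvd m 0 := dvd_zero _

theorem HalfDvd.add {m c d : ℤ} (hc : HalfDvd m c) (hd : HalfDvd m d) : HalfDvd m (c + d) :=
  dvd_add hc hd

theorem HalfDvd.mul {m m' c d : ℤ} (hc : HalfDvd m c) (hd : HalfDvd m' d) :
    HalfDvd (m + m') (c * d) := by
  have h := mul_dvd_mul hc hd
  rw [← pow_add] at h
  exact (pow_dvd_pow _ (by lia)).trans h

theorem HalfDvd.sum {ι : Type*} {s : Finset ι} {f : ι → ℤ} {m : ℤ}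
    (h : ∀ i ∈ s, HalfDvd m (f i)) : HalfDvd m (∑ i ∈ s, f i) := dvd_sum h

theorem HalfDvd.pow_dvd {m c : ℤ} (h : HalfDvd m c) {n : ℕ} (hn : 2 * n ≤ m + 1) :
    (3 : ℤ) ^ n ∣ c :=
  (pow_dvd_pow _ (by lia)).trans h

theorem halfDvd_of_pow_dvd {m c : ℤ} {n : ℕ} (h : (3 : ℤ) ^ n ∣ c) (hn : m ≤ 2 * n) :
    HalfDvd m c :=
  (pow_dvd_pow _ (by lia)).trans h

/-- The `j`-th coefficient of `p` is divisible by `3 ^ ((A j + s) / 2)`. -/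
def PolyHalfDvd (A s : ℤ) (p : Polynomial ℤ) : Prop :=
  ∀ j : ℕ, HalfDvd (A * j + s) (p.coeff j)

namespace PolyHalfDvd

variable {A s s' : ℤ} {p q : Polynomial ℤ}

theorem mono (h : PolyHalfDvd A s p) (hs : s' ≤ s) : PolyHalfDvd A s' p :=
  fun j => (h j).mono (by lia)

theorem add (hp : PolyHalfDvd A s p) (hq : PolyHalfDvd A s q) : PolyHalfDvd A s (p + q) :=
  fun j => by rw [Polynomial.coeff_add]; exact (hp j).add (hq j)

theorem sum {ι : Type*} {t : Finset ι} {f : ι → Polynomial ℤ}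
    (h : ∀ i ∈ t, PolyHalfDvd A s (f i)) : PolyHalfDvd A s (∑ i ∈ t, f i) :=
  fun j => by rw [Polynomial.finsetSum_coeff]; exact HalfDvd.sum fun i hi => h i hi j

theorem mul (hp : PolyHalfDvd A s p) (hq : PolyHalfDvd A s' q) :
    PolyHalfDvd A (s + s') (p * q) := by
  intro j
  rw [Polynomial.coeff_mul]
  refine HalfDvd.sum fun x hx => ?_
  have hx : x.1 + x.2 = j := HasAntidiagonal.mem_antidiagonal.1 hx
  have e : A * j + (s + s') = (A * x.1 + s) + (A * x.2 + s') := by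
    rw [← hx]; push_cast; ring
  rw [e]
  exact (hp _).mul (hq _)

theorem C_mul {c m : ℤ} (hc : HalfDvd m c) (hp : PolyHalfDvd A s p) :
    PolyHalfDvd A (m + s) (Polynomial.C c * p) := by
  intro j
  rw [Polynomial.coeff_C_mul, show A * j + (m + s) = m + (A * j + s) by ring]
  exact hc.mul (hp j)

theorem one : PolyHalfDvd A 0 1 := by
  intro j
  rw [Polynomial.coeff_one]
  split_ifs with h
  · subst h
    exact halfDvd_of_pow_dvd (n := 0) (by simp) (by simp)
  · exact halfDvd_zero _

theorem pow (hp : PolyHalfDvd A s p) (n : ℕ) : PolyHalfDvd A (n * s) (p ^ n) := by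
  induction n with
  | zero => simpa using one
  | succ n ih =>
    rw [pow_succ]
    exact (ih.mul hp).mono (by push_cast; linarith)

theorem X_mul (hp : PolyHalfDvd A s p) : PolyHalfDvd A (s - A) (Polynomial.X * p) := by
  intro j
  rcases j with _ | j
  · rw [Polynomial.coeff_X_mul_zero]; exact halfDvd_zero _
  · rw [Polynomial.coeff_X_mul]
    exact (hp j).mono (by push_cast; linarith)

theorem C_pow_dvd (hp : PolyHalfDvd A s p) {n : ℕ} (hA : 0 ≤ A) (hn : 2 * n ≤ A + s + 1)
    (h0 : p.coeff 0 = 0) : Polynomial.C ((3 : ℤ) ^ n) ∣ p := by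
  rw [Polynomial.C_dvd_iff_dvd_coeff]
  intro j
  rcases j with _ | j
  · rw [h0]; exact dvd_zero _
  · refine (hp _).pow_dvd ?_
    have : 0 ≤ A * j := by positivity
    push_cast
    linarith

end PolyHalfDvd

/-- The shift `-3` equals minus the slope, so substituting `levelPoly` preserves every bound of
slope 3. -/
theorem polyHalfDvd_levelPoly : PolyHalfDvd 3 (-3) levelPoly := by
  intro j
  have h : levelPoly.coeff j = (if j = 1 then 1 else 0) + 9 * (if j = 2 then 1 else 0) +
      27 * (if j = 3 then 1 else 0) := by
    rw [levelPoly, ← map_ofNat Polynomial.C, ← map_ofNat Polynomial.C, Polynomial.coeff_add,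
      Polynomial.coeff_add, Polynomial.coeff_C_mul, Polynomial.coeff_C_mul, Polynomial.coeff_X_pow,
      Polynomial.coeff_X_pow, Polynomial.coeff_X]
    simp only [eq_comm]
  rw [h]
  by_cases h1 : j = 1
  · subst h1; exact halfDvd_of_pow_dvd (n := 0) (by norm_num) (by norm_num)
  by_cases h2 : j = 2
  · subst h2; exact halfDvd_of_pow_dvd (n := 2) (by norm_num) (by norm_num)
  by_cases h3 : j = 3
  · subst h3; exact halfDvd_of_pow_dvd (n := 3) (by norm_num) (by norm_num)
  · rw [if_neg h1, if_neg h2, if_neg h3]; exact halfDvd_zero _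

theorem PolyHalfDvd.comp_levelPoly {s : ℤ} {p : Polynomial ℤ} (hp : PolyHalfDvd 3 s p) :
    PolyHalfDvd 3 s (p.comp levelPoly) := by
  rw [Polynomial.comp_eq_sum_left, Polynomial.sum_def]
  refine PolyHalfDvd.sum fun i _ => ?_
  exact ((polyHalfDvd_levelPoly.pow i).C_mul (hp i)).mono (by linarith)

theorem extractPoly_add_three (i : ℕ) : extractPoly (i + 3) = Polynomial.X *
    (Polynomial.C 27 * extractPoly (i + 2) + Polynomial.C 9 * extractPoly (i + 1) +
      extractPoly i) := by
  rw [extractPoly]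
  simp

theorem extractPoly_coeff_zero (i : ℕ) : (extractPoly i).coeff 0 = if i = 0 then 1 else 0 := by
  match i with
  | 0 => simp [extractPoly]
  | 1 => simp [extractPoly]
  | 2 => simp [extractPoly]
  | i + 3 => simp [extractPoly]

/-- In the recurrence the factors 27 and 9 compensate for the higher index, and multiplication by
`X` costs 9, matching `i ↦ i + 3`. The `-1` is forced by the coefficient 12 of `V₂`, which has only
one factor 3. -/
theorem polyHalfDvd_extractPoly (i : ℕ) : PolyHalfDvd 9 (-3 * i - 1) (extractPoly i) := by
  induction i using extractPoly.induct with
  | case1 => exact PolyHalfDvd.one.mono (by norm_num)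
  | case2 =>
    intro j
    rw [extractPoly, ← map_ofNat Polynomial.C, Polynomial.coeff_C_mul, Polynomial.coeff_X]
    split_ifs with h
    · subst h; exact halfDvd_of_pow_dvd (n := 3) (by norm_num) (by norm_num)
    · exact halfDvd_zero _
  | case3 =>
    intro j
    rw [extractPoly, ← map_ofNat Polynomial.C, ← map_ofNat Polynomial.C, Polynomial.coeff_add,
      Polynomial.coeff_C_mul, Polynomial.coeff_C_mul, Polynomial.coeff_X, Polynomial.coeff_X_pow]
    by_cases h1 : j = 1
    · subst h1; exact halfDvd_of_pow_dvd (n := 1) (by norm_num) (by norm_num)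
    by_cases h2 : j = 2
    · subst h2; exact halfDvd_of_pow_dvd (n := 6) (by norm_num) (by norm_num)
    · rw [if_neg (by lia), if_neg h2]; exact halfDvd_zero _
  | case4 i ih2 ih1 ih0 =>
    have h27 : HalfDvd 6 27 := halfDvd_of_pow_dvd (n := 3) (by norm_num) (by norm_num)
    have h9 : HalfDvd 4 9 := halfDvd_of_pow_dvd (n := 2) (by norm_num) (by norm_num)
    rw [extractPoly_add_three]
    have h := ((PolyHalfDvd.C_mul h27 ih2).mono (s' := -3 * i - 1) (by push_cast; linarith)).add
      ((PolyHalfDvd.C_mul h9 ih1).mono (s' := -3 * i - 1) (by push_cast; linarith)) |>.add ih0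
    exact h.X_mul.mono (by push_cast; linarith)

theorem PolyHalfDvd.extractPolyLin {s : ℤ} {p : Polynomial ℤ} (hp : PolyHalfDvd 3 s p) :
    PolyHalfDvd 9 (s - 1) (extractPolyLin p) := by
  rw [_root_.extractPolyLin, Polynomial.sum_def]
  refine PolyHalfDvd.sum fun i _ => ?_
  exact ((polyHalfDvd_extractPoly i).C_mul (hp i)).mono (by linarith)

theorem extractPolyLin_coeff_zero (p : Polynomial ℤ) :
    (extractPolyLin p).coeff 0 = p.coeff 0 := by
  induction p using Polynomial.induction_on' with
  | add p q hp hq => rw [extractPolyLin_add, Polynomial.coeff_add, hp, hq, Polynomial.coeff_add]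
  | monomial n a =>
    rw [← Polynomial.C_mul_X_pow_eq_monomial, extractPolyLin_C_mul_X_pow, Polynomial.coeff_C_mul,
      Polynomial.coeff_C_mul, extractPoly_coeff_zero, Polynomial.coeff_X_pow]
    simp only [eq_comm]

theorem comp_levelPoly_coeff_zero (p : Polynomial ℤ) :
    (p.comp levelPoly).coeff 0 = p.coeff 0 := by
  rw [Polynomial.coeff_zero_eq_eval_zero, Polynomial.eval_comp, Polynomial.coeff_zero_eq_eval_zero]
  simp [levelPoly]

/-- The point is `27 + 9 · 12 + 27 = 162 = 2 · 3⁴`: three terms of valuation 3 sum to valuation 4.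
-/
theorem extractPolyLin_levelPoly : extractPolyLin levelPoly =
    Polynomial.C 162 * Polynomial.X + Polynomial.C 21870 * Polynomial.X ^ 2 +
      Polynomial.C 531441 * Polynomial.X ^ 3 := by
  have h : levelPoly = Polynomial.C 1 * Polynomial.X ^ 1 + Polynomial.C 9 * Polynomial.X ^ 2 +
      Polynomial.C 27 * Polynomial.X ^ 3 := by
    simp [levelPoly]
  rw [h, extractPolyLin_add, extractPolyLin_add, extractPolyLin_C_mul_X_pow,
    extractPolyLin_C_mul_X_pow, extractPolyLin_C_mul_X_pow]
  simp only [extractPoly, map_ofNat, map_one]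
  ring

theorem exists_linear_add {p : Polynomial ℤ} {A s : ℤ} (h0 : p.coeff 0 = 0)
    (hp : PolyHalfDvd A s p) : ∃ r : Polynomial ℤ,
      p = Polynomial.C (p.coeff 1) * Polynomial.X + r ∧ r.coeff 0 = 0 ∧ r.coeff 1 = 0 ∧
        PolyHalfDvd A s r := by
  have hc (j : ℕ) : (p - Polynomial.C (p.coeff 1) * Polynomial.X).coeff j =
      if j = 1 then 0 else p.coeff j := by
    rw [Polynomial.coeff_sub, Polynomial.coeff_C_mul, Polynomial.coeff_X]
    split_ifs with h1 h2 h2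
    · subst h2; ring
    · exact absurd h1.symm h2
    · exact absurd h2.symm h1
    · ring
  refine ⟨p - Polynomial.C (p.coeff 1) * Polynomial.X, by ring, by simp [h0], by simp,
    fun j => ?_⟩
  rw [hc]
  split_ifs
  · exact halfDvd_zero _
  · exact hp j

theorem PolyHalfDvd.of_coeff_eq_zero {r : Polynomial ℤ} {A s B s' : ℤ} (h : PolyHalfDvd A s r)
    (h0 : r.coeff 0 = 0) (h1 : r.coeff 1 = 0) (hB : B ≤ A) (hs : B * 2 + s' ≤ A * 2 + s) :
    PolyHalfDvd B s' r := by
  intro j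
  rcases j with _ | _ | j
  · rw [h0]; exact halfDvd_zero _
  · rw [h1]; exact halfDvd_zero _
  · refine (h _).mono ?_
    push_cast
    nlinarith [mul_nonneg (sub_nonneg.2 hB) (Int.natCast_nonneg j)]

/-- The general bounds are too weak for the linear term, which is therefore handled through the
explicit `extractPolyLin_levelPoly`. In degrees at least 2 the drop from slope 9 to slope 3 leaves
room. -/
theorem polyHalfDvd_step_odd {s : ℤ} {p : Polynomial ℤ} (h0 : p.coeff 0 = 0)
    (hp : PolyHalfDvd 9 (s - 9) p) :
    PolyHalfDvd 3 (s + 5) (extractPolyLin (p.comp levelPoly)) := by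
  obtain ⟨r, hr, hr0, hr1, hrp⟩ := exists_linear_add h0 hp
  have hr' : PolyHalfDvd 9 (s + 2) (extractPolyLin (r.comp levelPoly)) :=
    (hrp.of_coeff_eq_zero (B := 3) (s' := s + 3) hr0 hr1 (by norm_num)
      (by linarith)).comp_levelPoly.extractPolyLin.mono (by linarith)
  have hr0' : (extractPolyLin (r.comp levelPoly)).coeff 0 = 0 := by
    rw [extractPolyLin_coeff_zero, comp_levelPoly_coeff_zero, hr0]
  have hc1 : HalfDvd s (p.coeff 1) := (hp 1).mono (by norm_num)
  have hlin : PolyHalfDvd 3 5 (extractPolyLin levelPoly) := by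
    intro j
    rw [extractPolyLin_levelPoly]
    simp only [Polynomial.coeff_add, Polynomial.coeff_C_mul, Polynomial.coeff_X_pow,
      Polynomial.coeff_X]
    by_cases h1 : j = 1
    · subst h1; exact halfDvd_of_pow_dvd (n := 4) (by norm_num) (by norm_num)
    by_cases h2 : j = 2
    · subst h2; exact halfDvd_of_pow_dvd (n := 7) (by norm_num) (by norm_num)
    by_cases h3 : j = 3
    · subst h3; exact halfDvd_of_pow_dvd (n := 12) (by norm_num) (by norm_num)
    · rw [if_neg (by lia), if_neg h2, if_neg h3]; exact halfDvd_zero _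
  rw [hr, Polynomial.add_comp, Polynomial.mul_comp, Polynomial.C_comp, Polynomial.X_comp,
    extractPolyLin_add, extractPolyLin_C_mul]
  refine (hlin.C_mul hc1).add fun j => ?_
  rcases j with _ | j
  · rw [hr0']; exact halfDvd_zero _
  · exact (hr' _).mono (by push_cast; linarith)

theorem polyHalfDvd_step_even {s : ℤ} {p : Polynomial ℤ} (hp : PolyHalfDvd 3 s p) :
    PolyHalfDvd 9 (s - 4) (extractPolyLin (Polynomial.X * p.comp levelPoly)) :=
  hp.comp_levelPoly.X_mul.extractPolyLin.mono (by linarith)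

/-! ### Iterated extraction from the generating function -/

/-- The series `∑ cφ₃(3 · 9^k n - (9^{k+1} - 1) / 8) qⁿ`. -/
noncomputable def frobeniusOdd : ℕ → ℤ⟦X⟧
  | 0 => extract (X * cphiSeries 3)
  | k + 1 => extract (X * extract (frobeniusOdd k))

theorem coeff_frobeniusOdd (k n N : ℕ) (h : 8 * N + 9 ^ (k + 1) = 24 * 9 ^ k * n + 1) :
    coeff n (frobeniusOdd k) = cphi 3 N := by
  induction k generalizing n with
  | zero =>
    rw [frobeniusOdd, coeff_extract, show 3 * n = N + 1 by lia, coeff_succ_X_mul, cphiSeries,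
      coeff_mk]
  | succ k ih =>
    -- For `n = 0` the hypothesis would need `8 * N + 9 ^ (k + 2) = 1`.
    have h9 : 0 < 9 ^ k := by positivity
    rcases n with _ | n
    · exfalso
      rw [pow_succ, pow_succ] at h
      lia
    · rw [frobeniusOdd, coeff_extract, show 3 * (n + 1) = 3 * n + 2 + 1 by ring, coeff_succ_X_mul,
        coeff_extract]
      refine ih _ ?_
      rw [pow_succ, pow_succ] at h
      rw [pow_succ]
      have e1 : 24 * (9 ^ k * 9) * (n + 1) = 216 * (9 ^ k * n) + 216 * 9 ^ k := by ring
      have e2 : 24 * 9 ^ k * (3 * (3 * n + 2)) = 216 * (9 ^ k * n) + 144 * 9 ^ k := by ring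
      lia

/-- With `s = 10k + 6`, the odd step passes from shift `s - 9` to `s + 5` and the even step to `s +
1`: a gain of 10 half-powers. The start is `27 t`. -/
theorem exists_frobeniusOdd_eq (k : ℕ) : ∃ p : Polynomial ℤ, p.coeff 0 = 0 ∧
    PolyHalfDvd 9 (10 * k - 3) p ∧
    frobeniusOdd k = dilate eulerInv ^ 3 * cubicTheta * Polynomial.aeval hauptThree p := by
  induction k with
  | zero =>
    refine ⟨Polynomial.C 27 * Polynomial.X, by simp, ?_, ?_⟩
    · intro j
      rw [Polynomial.coeff_C_mul, Polynomial.coeff_X]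
      split_ifs with h
      · subst h; exact halfDvd_of_pow_dvd (n := 3) (by norm_num) (by norm_num)
      · exact halfDvd_zero _
    · have h := extract_even 1
      rw [map_one, mul_one, mul_comm _ cubicTheta, ← cphiSeries_three_eq, Polynomial.one_comp,
        mul_one] at h
      have hX : extractPolyLin Polynomial.X = Polynomial.C 27 * Polynomial.X := by
        have := extractPolyLin_C_mul_X_pow 1 1
        simpa [extractPoly] using this
      rw [frobeniusOdd, h, hX]
  | succ k ih =>
    obtain ⟨p, h0, hp, h⟩ := ih
    refine ⟨extractPolyLin (Polynomial.X * (extractPolyLin (p.comp levelPoly)).comp levelPoly),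
      ?_, ?_, by rw [frobeniusOdd, h, extract_odd, extract_even]⟩
    · rw [extractPolyLin_coeff_zero, Polynomial.coeff_X_mul_zero]
    · have hp' : PolyHalfDvd 9 ((10 * k + 6) - 9) p := hp.mono (by linarith)
      exact (polyHalfDvd_step_even (polyHalfDvd_step_odd h0 hp')).mono (by push_cast; linarith)

theorem exists_extract_frobeniusOdd_eq (k : ℕ) : ∃ p : Polynomial ℤ, p.coeff 0 = 0 ∧
    PolyHalfDvd 3 (10 * k + 11) p ∧
    extract (frobeniusOdd k) = eulerInv ^ 3 * cubicTheta * Polynomial.aeval hauptThree p := by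
  obtain ⟨p, h0, hp, h⟩ := exists_frobeniusOdd_eq k
  have hp' : PolyHalfDvd 9 ((10 * k + 6) - 9) p := hp.mono (by linarith)
  refine ⟨extractPolyLin (p.comp levelPoly), ?_, (polyHalfDvd_step_odd h0 hp').mono (by linarith),
    by rw [h, extract_odd]⟩
  rw [extractPolyLin_coeff_zero, comp_levelPoly_coeff_zero, h0]

/-! ### The congruences -/

theorem C_dvd_mul_aeval {c : ℤ} {p : Polynomial ℤ} (h : Polynomial.C c ∣ p) (f : ℤ⟦X⟧) :
    (C c : ℤ⟦X⟧) ∣ f * Polynomial.aeval hauptThree p := by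
  refine Dvd.dvd.mul_left ?_ _
  have := map_dvd (Polynomial.aeval hauptThree) h
  rwa [Polynomial.aeval_C] at this

theorem dvd_coeff_of_C_dvd {c : ℤ} {f : ℤ⟦X⟧} (h : (C c : ℤ⟦X⟧) ∣ f) (n : ℕ) :
    c ∣ coeff n f := by
  obtain ⟨g, rfl⟩ := h
  rw [coeff_C_mul]
  exact dvd_mul_right _ _

theorem pow_dvd_coeff_frobeniusOdd (k n : ℕ) : (3 : ℤ) ^ (5 * k + 3) ∣ coeff n (frobeniusOdd k) := by
  obtain ⟨p, h0, hp, h⟩ := exists_frobeniusOdd_eq k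
  rw [h]
  exact dvd_coeff_of_C_dvd (C_dvd_mul_aeval
    (hp.C_pow_dvd (by norm_num) (by push_cast; linarith) h0) _) n

theorem pow_dvd_coeff_extract_frobeniusOdd (k n : ℕ) :
    (3 : ℤ) ^ (5 * k + 7) ∣ coeff n (extract (frobeniusOdd k)) := by
  obtain ⟨p, h0, hp, h⟩ := exists_extract_frobeniusOdd_eq k
  rw [h]
  exact dvd_coeff_of_C_dvd (C_dvd_mul_aeval
    (hp.C_pow_dvd (by norm_num) (by push_cast; linarith) h0) _) n

theorem PolyHalfDvd.C_pow_dvd_of_coeff_eq_zero {A s : ℤ} {r : Polynomial ℤ}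
    (hr : PolyHalfDvd A s r) {n : ℕ} (hA : 0 ≤ A) (hn : 2 * n ≤ A * 2 + s + 1)
    (h0 : r.coeff 0 = 0) (h1 : r.coeff 1 = 0) : Polynomial.C ((3 : ℤ) ^ n) ∣ r :=
  (hr.of_coeff_eq_zero (B := 0) (s' := 2 * n - 1) h0 h1 hA (by linarith)).C_pow_dvd le_rfl
    (by linarith) h0

theorem coeff_X_mul_dilate_eq_zero (f g : ℤ⟦X⟧) (n : ℕ) :
    coeff (3 * n + 2) (dilate g * (X * dilate f)) = 0 := by
  rw [mul_left_comm, ← map_mul, coeff_X_mul_dilate_of_mod_ne_one _ (by lia)]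

/-- Modulo 9, `a ≡ E³ / E(q³)` and `t ≡ w`, so the linear term is a multiple of `q E(q⁹)³ / E(q³)⁴`,
supported on exponents `1` mod 3. Higher powers of `t` are already divisible enough. -/
theorem pow_dvd_coeff_frobeniusOdd_of_mod (k n : ℕ) :
    (3 : ℤ) ^ (5 * k + 5) ∣ coeff (3 * n + 2) (frobeniusOdd k) := by
  obtain ⟨p, h0, hp, h⟩ := exists_frobeniusOdd_eq k
  obtain ⟨r, hr, hr0, hr1, hrp⟩ := exists_linear_add h0 hp
  have hc1 : (3 : ℤ) ^ (5 * k + 3) ∣ p.coeff 1 := (hp 1).pow_dvd (by push_cast; linarith)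
  have hr' : (3 : ℤ) ^ (5 * k + 5) ∣ coeff (3 * n + 2)
      (dilate eulerInv ^ 3 * cubicTheta * Polynomial.aeval hauptThree r) :=
    dvd_coeff_of_C_dvd (C_dvd_mul_aeval
      (hrp.C_pow_dvd_of_coeff_eq_zero (by norm_num) (by push_cast; linarith) hr0 hr1) _) _
  have hlin : (3 : ℤ) ^ 2 ∣ coeff (3 * n + 2) (dilate eulerInv ^ 3 * cubicTheta * hauptThree) := by
    have e : dilate eulerInv ^ 3 * cubicTheta * hauptThree =
        dilate (eulerInv ^ 4) * (X * dilate (dilate eulerSeries ^ 3)) +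
        C (3 ^ 2) * (dilate eulerInv ^ 4 * (thetaNine * hauptThree + eulerSeries ^ 3 *
          (hauptNine ^ 2 + 3 * hauptNine ^ 3))) := by
      have hc := thetaNine_eq_mul_hauptNine
      have ht := hauptThree_eq
      have hC : (C (3 ^ 2) : ℤ⟦X⟧) = 9 := by norm_num
      rw [map_pow, map_pow, ← thetaNine.eq_1, cubicTheta, ← thetaNine.eq_1, hC]
      linear_combination dilate eulerInv ^ 4 * eulerSeries ^ 3 * ht - dilate eulerInv ^ 4 * hc
    rw [e, map_add, coeff_X_mul_dilate_eq_zero, zero_add, coeff_C_mul]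
    exact dvd_mul_right _ _
  rw [h, hr, map_add, mul_add, map_add]
  refine dvd_add ?_ hr'
  have e : dilate eulerInv ^ 3 * cubicTheta *
      Polynomial.aeval hauptThree (Polynomial.C (p.coeff 1) * Polynomial.X) =
      C (p.coeff 1) * (dilate eulerInv ^ 3 * cubicTheta * hauptThree) := by
    rw [map_mul, Polynomial.aeval_C, Polynomial.aeval_X, mul_left_comm]
    rfl
  rw [e, coeff_C_mul, show 5 * k + 5 = 5 * k + 3 + 2 by ring, pow_add]
  exact mul_dvd_mul hc1 hlin

/-- Modulo 9 the linear term is a multiple of `w / E(q³)`, and `U(w) = 9t` supplies the additional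
`3²`. -/
theorem pow_dvd_coeff_extract_frobeniusOdd_of_mod (k n : ℕ) :
    (3 : ℤ) ^ (5 * k + 9) ∣ coeff (3 * n) (extract (frobeniusOdd k)) := by
  obtain ⟨p, h0, hp, h⟩ := exists_extract_frobeniusOdd_eq k
  obtain ⟨r, hr, hr0, hr1, hrp⟩ := exists_linear_add h0 hp
  have hc1 : (3 : ℤ) ^ (5 * k + 7) ∣ p.coeff 1 := (hp 1).pow_dvd (by push_cast; linarith)
  have hr' : (3 : ℤ) ^ (5 * k + 9) ∣ coeff (3 * n)
      (eulerInv ^ 3 * cubicTheta * Polynomial.aeval hauptThree r) :=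
    dvd_coeff_of_C_dvd (C_dvd_mul_aeval
      (hrp.C_pow_dvd_of_coeff_eq_zero (by norm_num) (by push_cast; linarith) hr0 hr1) _) _
  have hC : (C (3 ^ 2) : ℤ⟦X⟧) = 9 := by norm_num
  have hlin : (3 : ℤ) ^ 2 ∣ coeff (3 * n) (eulerInv ^ 3 * cubicTheta * hauptThree) := by
    have e : eulerInv ^ 3 * cubicTheta * hauptThree =
        dilate eulerInv * hauptNine +
        C (3 ^ 2) * (dilate eulerInv * (hauptNine * hauptThree +
          (hauptNine ^ 2 + 3 * hauptNine ^ 3))) := by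
      have ht := hauptThree_eq
      have hE : (eulerSeries * eulerInv) ^ 3 = 1 := by rw [eulerSeries_mul_eulerInv, one_pow]
      have hw : hauptNine = thetaNine * eulerInv ^ 3 := rfl
      rw [cubicTheta, ← thetaNine.eq_1, hC]
      linear_combination dilate eulerInv * ht + dilate eulerInv * hauptThree * hE -
        9 * dilate eulerInv * hauptThree * hw
    rw [e, map_add, coeff_C_mul, ← coeff_extract, extract_dilate_mul, extract_hauptNine, ← hC,
      mul_left_comm, coeff_C_mul]
    exact dvd_add (dvd_mul_right _ _) (dvd_mul_right _ _)
  rw [h, hr, map_add, mul_add, map_add]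
  refine dvd_add ?_ hr'
  have e : eulerInv ^ 3 * cubicTheta *
      Polynomial.aeval hauptThree (Polynomial.C (p.coeff 1) * Polynomial.X) =
      C (p.coeff 1) * (eulerInv ^ 3 * cubicTheta * hauptThree) := by
    rw [map_mul, Polynomial.aeval_C, Polynomial.aeval_X, mul_left_comm]
    rfl
  rw [e, coeff_C_mul, show 5 * k + 9 = 5 * k + 7 + 2 by ring, pow_add]
  exact mul_dvd_mul hc1 hlin

theorem nine_pow_mod_eight (k : ℕ) : 9 ^ k % 8 = 1 := by
  rw [Nat.pow_mod]; simp

theorem modEq_zero_of_dvd_coeff {k n N a b : ℕ} (h : (3 : ℤ) ^ b ∣ coeff n (frobeniusOdd k))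
    (hab : a ≤ b) (hN : 8 * N + 9 ^ (k + 1) = 24 * 9 ^ k * n + 1) :
    cphi 3 N ≡ 0 [MOD 3 ^ a] := by
  rw [Nat.modEq_zero_iff_dvd]
  rw [coeff_frobeniusOdd k n N hN] at h
  exact (pow_dvd_pow 3 hab).trans (by exact_mod_cast h)

/-- Each division by `8` is exact. -/
theorem theorem2 (k : ℕ) (hk : 3 ≤ k) (n : ℕ) :
    cphi 3 (3 ^ (2 * k) * n + (7 * 3 ^ (2 * k) + 1) / 8) ≡ 0 [MOD 3 ^ (4 * k + 5)] ∧
    cphi 3 (3 ^ (2 * k + 1) * n + (5 * 3 ^ (2 * k + 1) + 1) / 8) ≡ 0 [MOD 3 ^ (4 * k + 6)] ∧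
    cphi 3 (3 ^ (2 * k + 1) * n + (23 * 3 ^ (2 * k) + 1) / 8) ≡ 0 [MOD 3 ^ (4 * k + 7)] ∧
    cphi 3 (3 ^ (2 * k + 2) * n + (13 * 3 ^ (2 * k + 1) + 1) / 8) ≡ 0 [MOD 3 ^ (4 * k + 8)] := by
  obtain ⟨k, rfl⟩ : ∃ l, k = l + 1 := ⟨k - 1, by lia⟩
  have h9 := nine_pow_mod_eight k
  have e0 : 3 ^ (2 * (k + 1)) = 9 * 9 ^ k := by
    rw [pow_mul, pow_succ]; norm_num; ring
  have e1 : 3 ^ (2 * (k + 1) + 1) = 27 * 9 ^ k := by rw [pow_succ, e0]; ring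
  have e2 : 3 ^ (2 * (k + 1) + 2) = 81 * 9 ^ k := by rw [pow_succ, e1]; ring
  rw [e0, e1, e2]
  have f1 := pow_dvd_coeff_extract_frobeniusOdd k (n + 1)
  have f3 := pow_dvd_coeff_extract_frobeniusOdd_of_mod k (n + 1)
  rw [coeff_extract] at f1 f3
  -- In terms of the original `k`, the exponents available are `5k+2`, `5k+3`, `5k+4`, `5k+5`; each
  -- exceeds the one required by `k - 3`.
  refine ⟨modEq_zero_of_dvd_coeff f1 (by lia) ?_,
    modEq_zero_of_dvd_coeff (pow_dvd_coeff_frobeniusOdd (k + 1) (n + 1)) (by lia) ?_,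
    modEq_zero_of_dvd_coeff f3 (by lia) ?_,
    modEq_zero_of_dvd_coeff (pow_dvd_coeff_frobeniusOdd_of_mod (k + 1) n) (by lia) ?_⟩
  all_goals
    simp only [pow_succ]
    generalize 9 ^ k = m at h9
    ring_nf
    generalize m * n = x
    lia
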